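/- **Setting.** Let $f:\mathbb R^n\to\mathbb R$, $h=(h_1,\dots,h_{m_1})$ and $c=(c_1,\dots,c_{m_2})$ be continuously differentiable functions on $\mathbb R^n$, and consider $\min f(x)$ subject to $h(x)=0$, $c(x)\le 0$. Let $\|\cdot\|$ be the Euclidean norm, $K=\{0\}\times\mathbb R_-^{m_2}\subset\mathbb R^{m_1+m_2}$, and let $\mathrm{dist}(\cdot\mid K)$ be the $\ell_\infty$ distance to $K$. Put $$\phi(x)=\mathrm{dist}\big((h(x),c(x))\mid K\big),\qquad \kappa(x,\sigma)=\inf_{\|p\|_\infty\le\sigma}\mathrm{dist}\big((h(x)+\nabla h(x)^Tp,\ c(x)+\nabla c(x)^Tp)\mid K\big),$$ $\Delta_\phi(x,\sigma)=\phi(x)-\kappa(x,\sigma)$, and $$\chi(x)=-\min\{\nabla f(x)^Tt:\ \nabla h(x)^Tt=0,\ \nabla c(x)^Tt\le 0,\ \|t\|_\infty\le\tfrac12\beta_l\}.$$ **Algorithm (stochastic SQP).** Parameters: $0<2\sigma_u<\beta_l<\beta_u$, $\kappa_u>0$, $\gamma>1$, $\theta\in(0,1)$, $\alpha_{\max}>0$,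 $\rho_0>0$, $p_f\in(0,1]$, $p_0^g>0$, $\zeta_0,\zeta_c>0$, a nondecreasing sequence $a_j\in(0,1)$ with $a_0\ge p_0^g$ and $\sum_j(1-a_j)<\infty$, a starting point $x_0$, and $\alpha_0=\gamma^{j_0}\alpha_{\max}$ with an integer $j_0<0$; set $j=1$. At iteration $k=0,1,2,\dots$: * Let $\sigma_k=\min\{\sigma_u,\kappa_u\phi(x_k)\}$ and $\kappa_k=\kappa(x_k,\sigma_k)$; choose $\beta_k\in[\beta_l,\beta_u]$ and a matrix $H_k$ (with $H_k=H_{k-1}$ if $k\ge1$ and $x_k=x_{k-1}$), both determined by the past. Compute a random gradient estimate $g_k$, and let $d_k$ minimize $g_k^Td+\frac12d^TH_kd$ subject to $-\kappa_ke\le h(x_k)+\nabla h(x_k)^Td\le\kappa_ke$, $c(x_k)+\nabla c(x_k)^Td\le\kappa_ke$, $\|d\|_\infty\le\beta_k$, where $e$ is the vector of ones. * If $\|g_k\|>\zeta_k$, set $\zeta_{k+1}=\max\{\zeta_k+\zeta_c,\|g_k\|\}$, $p^g_{k+1}=a_j$ and then $j\leftarrow j+1$; otherwise set $\zeta_{k+1}=\zeta_k$,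 $p^g_{k+1}=p^g_k$. * Let $\Delta_k(\rho)=-g_k^Td_k+\rho\,\Delta_\phi(x_k,\sigma_k)$. If $\Delta_k(\rho_k)\ge\frac12d_k^TH_kd_k$, set $\rho_{k+1}=\rho_k$; otherwise set $\rho_{k+1}=\max\{(g_k^Td_k+\frac12d_k^TH_kd_k)/\Delta_\phi(x_k,\sigma_k),\,2\rho_k\}$. * Compute random estimates $f_k^0$ of $f(x_k)$ and $f_k^s$ of $f(x_k+\alpha_kd_k)$. If $f_k^0+\rho_{k+1}\phi(x_k)-f_k^s-\rho_{k+1}\phi(x_k+\alpha_kd_k)\ge\theta\alpha_k\Delta_k(\rho_{k+1})$, set $x_{k+1}=x_k+\alpha_kd_k$ and $\alpha_{k+1}=\min\{\gamma\alpha_k,\alpha_{\max}\}$; otherwise set $x_{k+1}=x_k$ and $\alpha_{k+1}=\gamma^{-1}\alpha_k$. Let $\mathcal F_{k-1}$ be the $\sigma$-algebra generated by $g_i,f_i^0,f_i^s$ for $i<k$, and let $\mathcal F_{k-1/2}$ be generated by $\mathcal F_{k-1}$ and $g_k$. **Assumptions.** 1. (A1)–(A4): There is a bounded closed set $\Omega$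 that almost surely contains all iterates $x_k$ and all trial points $x_k+\alpha d_k$, $0\le\alpha\le\alpha_k$. On $\Omega$, $f$ is bounded below, $h$, $c$ and their gradients are bounded, and $\nabla f$, $\nabla h_i$, $\nabla c_j$ are Lipschitz continuous. There are constants $\xi,M_H>0$ such that almost surely $2\xi\|d\|^2\le d^TH_kd\le M_H\|d\|^2$ for all $k$ and all $d\in\mathbb R^n$. 2. (Probabilistic accuracy): For some $\kappa_g>0$ and $0<\varepsilon_f<\frac{\xi\theta}{4\alpha_{\max}}$, the events $I_k=\{\|g_k-\nabla f(x_k)\|\le\kappa_g\alpha_k\|d_k\|\}$ and $J_k=\{|f_k^0-f(x_k)|\le\varepsilon_f\alpha_k^2\|d_k\|^2\text{ and }|f_k^s-f(x_k+\alpha_kd_k)|\le\varepsilon_f\alpha_k^2\|d_k\|^2\}$ satisfy, almost surely for all $k$, $\Pr(I_k\mid\mathcal F_{k-1})\ge p_k^g$ and $\Pr(J_k\mid\mathcal F_{k-1/2})\ge p_f$. The probabilities are large enough that $p_f\,p_0^g>\frac12$. 3. (eMFCQ): Almost surely, every accumulation point $x$ of $\{x_k\}$ satisfies the extended MFCQ: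 the gradients $\nabla h_i(x)$ are linearly independent, and there is $z\in\mathbb R^n$ with $\nabla h(x)^Tz=0$ and $\nabla c_i(x)^Tz<0$ for all $i$ with $c_i(x)\ge0$. 4. (Variance condition): For some $\kappa_f>0$ and all $k$, the squared errors $|f_k^s-f(x_k+\alpha_kd_k)|^2$ and $|f_k^0-f(x_k)|^2$ are integrable, and their conditional expectations given $\mathcal F_{k-1/2}$ are almost surely at most $\kappa_f^2\alpha_k^2(\phi(x_k)^2+\chi(x_k)^2)^2$. **Claim.** Almost surely, on the event that the sequence of gradient estimates $\{g_k\}$ or the sequence of penalty parameters $\{\rho_k\}$ is bounded, $$\liminf_{k\to\infty}\ \big(\phi(x_k)^2+\chi(x_k)^2\big)=0 .$$ -/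

import Mathlib

open MeasureTheory Filter
open scoped Gradient RealInnerProductSpace

namespace StochSQP

noncomputable section

/-- `ℝⁿ` with the Euclidean norm. -/
abbrev Vec (n : ℕ) : Type := EuclideanSpace ℝ (Fin n)

/-- The `ℓ∞` norm on `ℝⁿ`. -/
def supNorm {n : ℕ} (p : Vec n) : ℝ := ‖WithLp.ofLp p‖

/-- The quadratic form `dᵀ H d`. -/
def quadForm {n : ℕ} (H : Matrix (Fin n) (Fin n) ℝ) (d : Vec n) : ℝ :=
  WithLp.ofLp d ⬝ᵥ H.mulVec (WithLp.ofLp d)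

/-- The data of `min f(x)` subject to `h(x) = 0`, `c(x) ≤ 0`. -/
structure Problem (n m₁ m₂ : ℕ) where
  f : Vec n → ℝ
  h : Fin m₁ → Vec n → ℝ
  c : Fin m₂ → Vec n → ℝ

/-- `K = {0} × ℝ₋^{m₂}`; the ambient product carries the `ℓ∞` metric. -/
def coneK (m₁ m₂ : ℕ) : Set ((Fin m₁ → ℝ) × (Fin m₂ → ℝ)) :=
  {y | y.1 = 0 ∧ ∀ j, y.2 j ≤ 0}

namespace Problem

variable {n m₁ m₂ : ℕ} (P : Problem n m₁ m₂)

/-- Infeasibility `φ(x)`: the `ℓ∞` distance of `(h(x), c(x))` to `K`. -/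
def phi (x : Vec n) : ℝ :=
  Metric.infDist ((fun i => P.h i x), (fun j => P.c j x)) (coneK m₁ m₂)

/-- Infeasibility of the constraints linearized at `x`, for the step `p`. -/
def linPhi (x p : Vec n) : ℝ :=
  Metric.infDist ((fun i => P.h i x + ⟪∇ (P.h i) x, p⟫), (fun j => P.c j x + ⟪∇ (P.c j) x, p⟫))
    (coneK m₁ m₂)

/-- `κ(x, σ)`: the least linearized infeasibility over `‖p‖_∞ ≤ σ`. -/
def kappa (x : Vec n) (σ : ℝ) : ℝ :=
  sInf (P.linPhi x '' {p | supNorm p ≤ σ})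

/-- `Δ_φ(x, σ) = φ(x) - κ(x, σ)`. -/
def deltaPhi (x : Vec n) (σ : ℝ) : ℝ := P.phi x - P.kappa x σ

/-- The feasible set of the quadratic subproblem at `x`, with relaxation `κ` and radius `β`. -/
def qpFeasible (x : Vec n) (κ β : ℝ) : Set (Vec n) :=
  {d | (∀ i, -κ ≤ P.h i x + ⟪∇ (P.h i) x, d⟫ ∧ P.h i x + ⟪∇ (P.h i) x, d⟫ ≤ κ) ∧
    (∀ j, P.c j x + ⟪∇ (P.c j) x, d⟫ ≤ κ) ∧ supNorm d ≤ β}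

/-- The stationarity measure `χ(x) = -min ∇f(x)ᵀt` over `∇h(x)ᵀt = 0`, `∇c(x)ᵀt ≤ 0`,
`‖t‖_∞ ≤ β_l / 2`. The feasible set is compact and contains `0`. -/
def chi (βl : ℝ) (x : Vec n) : ℝ :=
  -sInf ((fun t : Vec n => ⟪∇ P.f x, t⟫) ''
    {t | (∀ i, ⟪∇ (P.h i) x, t⟫ = 0) ∧ (∀ j, ⟪∇ (P.c j) x, t⟫ ≤ 0) ∧ supNorm t ≤ βl / 2})

/-- The extended Mangasarian-Fromovitz constraint qualification at `x`. -/
def EMFCQ (x : Vec n) : Prop :=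
  LinearIndependent ℝ (fun i => ∇ (P.h i) x) ∧
    ∃ z : Vec n, (∀ i, ⟪∇ (P.h i) x, z⟫ = 0) ∧ ∀ j, 0 ≤ P.c j x → ⟪∇ (P.c j) x, z⟫ < 0

end Problem

/-- The user-chosen parameters of the stochastic SQP algorithm. -/
structure Params where
  (σu κu βl βu γ θ αmax ρ0 pf pg0 ζ0 ζc : ℝ)
  (a : ℕ → ℝ)
  (j0 : ℤ)
  σu_pos : 0 < σu
  κu_pos : 0 < κu
  σu_βl : 2 * σu < βl
  βl_βu : βl < βu
  γ_gt : 1 < γ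
  θ_pos : 0 < θ
  θ_lt : θ < 1
  αmax_pos : 0 < αmax
  ρ0_pos : 0 < ρ0
  pf_pos : 0 < pf
  pf_le : pf ≤ 1
  pg0_pos : 0 < pg0
  ζ0_pos : 0 < ζ0
  ζc_pos : 0 < ζc
  a_mono : Monotone a
  a_zero : pg0 ≤ a 0
  a_pos : ∀ j, 0 < a j
  a_lt : ∀ j, a j < 1
  a_summable : Summable fun j => 1 - a j
  j0_neg : j0 < 0

/-- The random quantities handled by the algorithm, on a sample space `S`: iterates `x`, gradient
estimates `g`, search directions `d`, matrices `H`, radii `β`, function estimates `f0` (at `x k`)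
and `fs` (at `x k + α k • d k`), step sizes `α`, penalty parameters `ρ`, thresholds `ζ`,
probabilities `pg` and the counter `j`. -/
structure Run (n : ℕ) (S : Type*) where
  x : ℕ → S → Vec n
  g : ℕ → S → Vec n
  d : ℕ → S → Vec n
  H : ℕ → S → Matrix (Fin n) (Fin n) ℝ
  β : ℕ → S → ℝ
  f0 : ℕ → S → ℝ
  fs : ℕ → S → ℝ
  α : ℕ → S → ℝ
  ρ : ℕ → S → ℝ
  ζ : ℕ → S → ℝ
  pg : ℕ → S → ℝ
  j : ℕ → S → ℕ

namespace Run

variable {n m₁ m₂ : ℕ} {S : Type*} (R : Run n S) (P : Problem n m₁ m₂) (A : Params)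

/-- `σ_k = min {σ_u, κ_u φ(x_k)}`. -/
def sigma (k : ℕ) (ω : S) : ℝ := min A.σu (A.κu * P.phi (R.x k ω))

/-- `Δ_φ(x_k, σ_k)`. -/
def dPhi (k : ℕ) (ω : S) : ℝ := P.deltaPhi (R.x k ω) (R.sigma P A k ω)

/-- The objective `g_kᵀ d + ½ dᵀ H_k d` of the quadratic subproblem. -/
def qpObj (k : ℕ) (ω : S) (d : Vec n) : ℝ := ⟪R.g k ω, d⟫ + quadForm (R.H k ω) d / 2

/-- The feasible set of the quadratic subproblem at iteration `k`. -/
def qpSet (k : ℕ) (ω : S) : Set (Vec n) :=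
  P.qpFeasible (R.x k ω) (P.kappa (R.x k ω) (R.sigma P A k ω)) (R.β k ω)

/-- The trial point `x_k + α_k d_k`. -/
def trial (k : ℕ) (ω : S) : Vec n := R.x k ω + R.α k ω • R.d k ω

/-- The predicted reduction `-g_kᵀ d_k + ρ Δ_φ(x_k, σ_k)`. -/
def predRed (k : ℕ) (ω : S) (ρ : ℝ) : ℝ := -⟪R.g k ω, R.d k ω⟫ + ρ * R.dPhi P A k ω

/-- The test that leaves the penalty parameter unchanged. -/
def PenaltyOk (k : ℕ) (ω : S) : Prop :=
  quadForm (R.H k ω) (R.d k ω) / 2 ≤ R.predRed P A k ω (R.ρ k ω)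

/-- The stochastic line search test; the step is successful if it holds. -/
def Success (k : ℕ) (ω : S) : Prop :=
  A.θ * R.α k ω * R.predRed P A k ω (R.ρ (k + 1) ω) ≤
    (R.f0 k ω + R.ρ (k + 1) ω * P.phi (R.x k ω)) -
      (R.fs k ω + R.ρ (k + 1) ω * P.phi (R.trial k ω))

/-- `𝓕_{k-1}`: generated by `g_i`, `f_i^0`, `f_i^s` for `i < k` (trivial if `k = 0`). -/
def past (k : ℕ) : MeasurableSpace S :=
  ⨆ i : Fin k, MeasurableSpace.comap (R.g i) inferInstance ⊔
    MeasurableSpace.comap (R.f0 i) inferInstance ⊔ MeasurableSpace.comap (R.fs i) inferInstance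

/-- `𝓕_{k-1/2}`: generated by `𝓕_{k-1}` and `g_k`. -/
def halfPast (k : ℕ) : MeasurableSpace S :=
  R.past k ⊔ MeasurableSpace.comap (R.g k) inferInstance

/-- The random quantities `R` are generated by the stochastic SQP algorithm with parameters `A`
from the starting point `x₀`. -/
structure IsGenerated [MeasurableSpace S] (x₀ : Vec n) : Prop where
  g_meas : ∀ k, Measurable (R.g k)
  f0_meas : ∀ k, Measurable (R.f0 k)
  fs_meas : ∀ k, Measurable (R.fs k)
  H_meas : ∀ k p q, Measurable[R.past k] fun ω => R.H k ω p q
  β_meas : ∀ k, Measurable[R.past k] (R.β k)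
  d_meas : ∀ k, Measurable[R.halfPast k] (R.d k)
  x_init : ∀ ω, R.x 0 ω = x₀
  α_init : ∀ ω, R.α 0 ω = A.γ ^ A.j0 * A.αmax
  ρ_init : ∀ ω, R.ρ 0 ω = A.ρ0
  ζ_init : ∀ ω, R.ζ 0 ω = A.ζ0
  pg_init : ∀ ω, R.pg 0 ω = A.pg0
  j_init : ∀ ω, R.j 0 ω = 1
  β_mem : ∀ k ω, R.β k ω ∈ Set.Icc A.βl A.βu
  -- the matrix is recomputed only after a nonzero step
  H_keep : ∀ k ω, R.x (k + 1) ω = R.x k ω → R.H (k + 1) ω = R.H k ω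
  -- `d_k` solves the quadratic subproblem
  d_mem : ∀ k ω, R.d k ω ∈ R.qpSet P A k ω
  d_min : ∀ k ω, IsMinOn (R.qpObj k ω) (R.qpSet P A k ω) (R.d k ω)
  -- monitoring the size of `g_k`
  large : ∀ k ω, R.ζ k ω < ‖R.g k ω‖ →
    R.ζ (k + 1) ω = max (R.ζ k ω + A.ζc) ‖R.g k ω‖ ∧
      R.pg (k + 1) ω = A.a (R.j k ω) ∧ R.j (k + 1) ω = R.j k ω + 1
  small : ∀ k ω, ‖R.g k ω‖ ≤ R.ζ k ω →
    R.ζ (k + 1) ω = R.ζ k ω ∧ R.pg (k + 1) ω = R.pg k ω ∧ R.j (k + 1) ω = R.j k ω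
  -- penalty update; if the test fails, then `Δ_φ(x_k, σ_k) > 0` automatically
  penalty_keep : ∀ k ω, R.PenaltyOk P A k ω → R.ρ (k + 1) ω = R.ρ k ω
  penalty_raise : ∀ k ω, ¬ R.PenaltyOk P A k ω →
    R.ρ (k + 1) ω = max (R.qpObj k ω (R.d k ω) / R.dPhi P A k ω) (2 * R.ρ k ω)
  -- line search
  success : ∀ k ω, R.Success P A k ω →
    R.x (k + 1) ω = R.trial k ω ∧ R.α (k + 1) ω = min (A.γ * R.α k ω) A.αmax
  failure : ∀ k ω, ¬ R.Success P A k ω →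
    R.x (k + 1) ω = R.x k ω ∧ R.α (k + 1) ω = A.γ⁻¹ * R.α k ω

/-- Boundedness and smoothness on a bounded closed set `Om` that contains the iterates and the
trial points, and uniform bounds on the matrices `H_k`. -/
structure Regular [MeasurableSpace S] (μ : Measure S) (Om : Set (Vec n))
    (Lf : ℝ) (Lh : Fin m₁ → ℝ) (Lc : Fin m₂ → ℝ) (ξ MH : ℝ) : Prop where
  bounded : Bornology.IsBounded Om
  closed : IsClosed Om
  mem : ∀ᵐ ω ∂μ, ∀ k, ∀ α ∈ Set.Icc 0 (R.α k ω), R.x k ω + α • R.d k ω ∈ Om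
  f_smooth : ContDiff ℝ 1 P.f
  h_smooth : ∀ i, ContDiff ℝ 1 (P.h i)
  c_smooth : ∀ j, ContDiff ℝ 1 (P.c j)
  f_below : BddBelow (P.f '' Om)
  f_lip : ∀ x ∈ Om, ∀ y ∈ Om, ‖∇ P.f x - ∇ P.f y‖ ≤ Lf * ‖x - y‖
  h_bdd : ∀ i, Bornology.IsBounded (P.h i '' Om) ∧ Bornology.IsBounded (∇ (P.h i) '' Om)
  h_lip : ∀ i, ∀ x ∈ Om, ∀ y ∈ Om, ‖∇ (P.h i) x - ∇ (P.h i) y‖ ≤ Lh i * ‖x - y‖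
  c_bdd : ∀ j, Bornology.IsBounded (P.c j '' Om) ∧ Bornology.IsBounded (∇ (P.c j) '' Om)
  c_lip : ∀ j, ∀ x ∈ Om, ∀ y ∈ Om, ‖∇ (P.c j) x - ∇ (P.c j) y‖ ≤ Lc j * ‖x - y‖
  ξ_pos : 0 < ξ
  MH_pos : 0 < MH
  H_bdd : ∀ᵐ ω ∂μ, ∀ k, ∀ d : Vec n,
    2 * ξ * ‖d‖ ^ 2 ≤ quadForm (R.H k ω) d ∧ quadForm (R.H k ω) d ≤ MH * ‖d‖ ^ 2

/-- The event `I_k` that the gradient estimate is `κ_g`-sufficiently accurate. -/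
def gradAcc (κg : ℝ) (k : ℕ) : Set S :=
  {ω | ‖R.g k ω - ∇ P.f (R.x k ω)‖ ≤ κg * R.α k ω * ‖R.d k ω‖}

/-- The event `J_k` that the function estimates are `ε_f`-sufficiently accurate. -/
def funAcc (εf : ℝ) (k : ℕ) : Set S :=
  {ω | |R.f0 k ω - P.f (R.x k ω)| ≤ εf * R.α k ω ^ 2 * ‖R.d k ω‖ ^ 2 ∧
    |R.fs k ω - P.f (R.trial k ω)| ≤ εf * R.α k ω ^ 2 * ‖R.d k ω‖ ^ 2}

/-- Probabilistic accuracy: `Pr(I_k | 𝓕_{k-1}) ≥ p_k^g` and `Pr(J_k | 𝓕_{k-1/2}) ≥ p_f`. -/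
structure ProbAccurate [MeasurableSpace S] (μ : Measure S) (κg εf : ℝ) : Prop where
  grad : ∀ k, ∀ᵐ ω ∂μ,
    R.pg k ω ≤ (μ[(R.gradAcc P κg k).indicator (fun _ => (1 : ℝ)) | R.past k]) ω
  func : ∀ k, ∀ᵐ ω ∂μ,
    A.pf ≤ (μ[(R.funAcc P εf k).indicator (fun _ => (1 : ℝ)) | R.halfPast k]) ω

/-- The extended MFCQ holds almost surely at every accumulation point of the iterates. -/
def EMFCQAtAccPts [MeasurableSpace S] (μ : Measure S) : Prop :=
  ∀ᵐ ω ∂μ, ∀ y : Vec n, MapClusterPt y atTop (fun k => R.x k ω) → P.EMFCQ y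

/-- The optimality measure `φ(x_k)² + χ(x_k)²`. -/
def optMeasure (k : ℕ) (ω : S) : ℝ := P.phi (R.x k ω) ^ 2 + P.chi A.βl (R.x k ω) ^ 2

/-- The `κ_f`-variance condition on the function estimates. -/
structure VarianceCond [MeasurableSpace S] (μ : Measure S) (κf : ℝ) : Prop where
  fs_int : ∀ k, Integrable (fun ω => |R.fs k ω - P.f (R.trial k ω)| ^ 2) μ
  f0_int : ∀ k, Integrable (fun ω => |R.f0 k ω - P.f (R.x k ω)| ^ 2) μ
  fs_var : ∀ k, ∀ᵐ ω ∂μ,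
    (μ[fun ω' => |R.fs k ω' - P.f (R.trial k ω')| ^ 2 | R.halfPast k]) ω ≤
      κf ^ 2 * R.α k ω ^ 2 * R.optMeasure P A k ω ^ 2
  f0_var : ∀ k, ∀ᵐ ω ∂μ,
    (μ[fun ω' => |R.f0 k ω' - P.f (R.x k ω')| ^ 2 | R.halfPast k]) ω ≤
      κf ^ 2 * R.α k ω ^ 2 * R.optMeasure P A k ω ^ 2

end Run

end

end StochSQP

/-!
Near a point satisfying the extended MFCQ, a step of size `min σu (κu φ)` reduces the linearised
infeasibility by a fixed fraction of `φ`. Along a sample path all of whose accumulation points have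
this property, bounded gradient estimates therefore need only finitely many updates of the penalty
parameter, so that in either case `ρ` is eventually constant and `f + ρ φ` is eventually a fixed
merit function.

Suppose that `φ² + χ²` stays above some `ε > 0`. Then the search directions of accurate iterations
with small step size are bounded away from `0`; these iterations pass the acceptance test, and each
accepted accurate step decreases the merit function by at least a constant multiple of `α`. As
iterations are accurate with conditional probability more than `1/2`, the martingale argument for
walks with bounded increments shows that `α` exceeds a fixed positive level infinitely often.
Iterating Lévy's conditional Borel–Cantelli lemma, arbitrarily long runs of accurate iterations
start at such times. Throughout such a run `α` stays above a fixed positive level, and the sum of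
`log α / log γ` and a suitable multiple of the merit function drops by at least `1` at every step,
which is impossible for a bounded quantity.
-/

namespace StochSQP

open scoped Topology NNReal ProbabilityTheory

section Analysis

variable {E : Type*} [NormedAddCommGroup E] [InnerProductSpace ℝ E]

lemma exists_biorthogonal [FiniteDimensional ℝ E] {ι : Type*} [DecidableEq ι] {v : ι → E}
    (hv : LinearIndependent ℝ v) : ∃ b : ι → E, ∀ i j, ⟪v i, b j⟫ = if i = j then 1 else 0 := by
  suffices ∀ j, ∃ b : E, ∀ i, ⟪v i, b⟫ = if i = j then 1 else 0 by
    choose b hb using this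
    exact ⟨b, fun i j => hb j i⟩
  intro j
  obtain ⟨l, hl⟩ := LinearMap.exists_extend (Finsupp.lapply j ∘ₗ hv.repr)
  have hlv : ∀ i, l (v i) = if i = j then 1 else 0 := fun i => by
    have h := LinearMap.congr_fun hl ⟨v i, Submodule.subset_span ⟨i, rfl⟩⟩
    have hrepr := hv.repr_eq_single i ⟨v i, Submodule.subset_span ⟨i, rfl⟩⟩ rfl
    simpa only [LinearMap.comp_apply, Submodule.subtype_apply, hrepr, Finsupp.lapply_apply,
      Finsupp.single_apply] using h
  refine ⟨(InnerProductSpace.toDual ℝ E).symm (LinearMap.toContinuousLinearMap l), fun i => ?_⟩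
  rw [real_inner_comm, InnerProductSpace.toDual_symm_apply]
  exact hlv i

lemma continuous_gradient [CompleteSpace E] {F : E → ℝ} (hF : ContDiff ℝ 1 F) :
    Continuous (∇ F) :=
  (InnerProductSpace.toDual ℝ E).symm.continuous.comp (hF.continuous_fderiv one_ne_zero)

lemma abs_sub_sub_inner_gradient_le [CompleteSpace E] {F : E → ℝ} {x y : E} {L : ℝ≥0}
    (hF : ∀ z ∈ segment ℝ x y, DifferentiableAt ℝ F z)
    (hL : LipschitzOnWith L (∇ F) (segment ℝ x y)) :
    |F y - F x - ⟪∇ F x, y - x⟫| ≤ L * ‖y - x‖ ^ 2 := by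
  have hbound : ∀ z ∈ segment ℝ x y, ‖fderiv ℝ F z - fderiv ℝ F x‖ ≤ L * ‖y - x‖ := by
    intro z hz
    rw [← toDual_gradient, ← toDual_gradient, ← map_sub, LinearIsometryEquiv.norm_map]
    refine (hL.norm_sub_le hz (left_mem_segment ℝ x y)).trans ?_
    gcongr
    exact norm_sub_le_of_mem_segment hz
  have := Convex.norm_image_sub_le_of_norm_fderiv_le' hF hbound (convex_segment x y)
    (left_mem_segment ℝ x y) (right_mem_segment ℝ x y)
  rwa [Real.norm_eq_abs, ← inner_gradient_left, mul_assoc, ← sq] at this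

lemma exists_eventually_mul_le_of_mapClusterPt {X ι : Type*} [TopologicalSpace X] {K : Set X}
    (hK : IsCompact K) {l : Filter ι} {x : ι → X} (hx : ∀ᶠ k in l, x k ∈ K) {F G : X → ℝ}
    (hF : ∀ z, 0 ≤ F z)
    (h : ∀ y, MapClusterPt y l x → ∃ c > 0, ∀ᶠ z in 𝓝 y, c * F z ≤ G z) :
    ∃ c > 0, ∀ᶠ k in l, c * F (x k) ≤ G (x k) := by
  suffices ∃ c > 0, ∀ᶠ k in l, x k ∈ K → c * F (x k) ≤ G (x k) by
    obtain ⟨c, hc, hk⟩ := this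
    exact ⟨c, hc, by filter_upwards [hk, hx] with k h₁ h₂ using h₁ h₂⟩
  clear hx
  refine hK.induction_on (p := fun s => ∃ c > 0, ∀ᶠ k in l, x k ∈ s → c * F (x k) ≤ G (x k))
    ⟨1, one_pos, .of_forall fun _ hk => hk.elim⟩ ?_ ?_ fun y _ => ?_
  · rintro s t hst ⟨c, hc, hk⟩
    exact ⟨c, hc, hk.mono fun _ hk hs => hk (hst hs)⟩
  · rintro s t ⟨c₁, hc₁, hk₁⟩ ⟨c₂, hc₂, hk₂⟩
    refine ⟨min c₁ c₂, lt_min hc₁ hc₂, ?_⟩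
    filter_upwards [hk₁, hk₂] with k h₁ h₂ hk
    rcases hk with hk | hk
    · exact (mul_le_mul_of_nonneg_right (min_le_left _ _) (hF _)).trans (h₁ hk)
    · exact (mul_le_mul_of_nonneg_right (min_le_right _ _) (hF _)).trans (h₂ hk)
  · by_cases hy : MapClusterPt y l x
    · obtain ⟨c, hc, hz⟩ := h y hy
      exact ⟨_, nhdsWithin_le_nhds hz, c, hc, .of_forall fun _ hk => hk⟩
    · simp only [mapClusterPt_iff_frequently, not_forall, not_frequently] at hy
      obtain ⟨s, hs, hk⟩ := hy
      exact ⟨s, nhdsWithin_le_nhds hs, 1, one_pos, hk.mono fun _ hk hks => absurd hks hk⟩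

lemma eventually_eventually_add_mul_le {X : Type*} [TopologicalSpace X] {F G : X → ℝ} {y : X}
    {a : ℝ} (hF : ContinuousAt F y) (hG : ContinuousAt G y) (ha : F y < a) :
    ∀ᶠ s in 𝓝 (0 : ℝ), ∀ᶠ x in 𝓝 y, F x + s * G x ≤ a := by
  have h : Tendsto (fun z : ℝ × X => F z.2 + z.1 * G z.2) (𝓝 0 ×ˢ 𝓝 y) (𝓝 (F y + 0 * G y)) :=
    (hF.tendsto.comp tendsto_snd).add (tendsto_fst.mul (hG.tendsto.comp tendsto_snd))
  exact (h.eventually_le_const (by simpa using ha)).curry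

lemma liminf_coe_ereal_eq_zero {ι : Type*} {l : Filter ι} {u : ι → ℝ} (h₀ : ∀ k, 0 ≤ u k)
    (h : ∀ ε > 0, ∃ᶠ k in l, u k < ε) : liminf (fun k => (u k : EReal)) l = 0 := by
  refine le_antisymm (EReal.le_of_forall_lt_iff_le.1 fun ε hε => ?_)
    (le_liminf_of_le (by isBoundedDefault) (.of_forall fun k => by exact_mod_cast h₀ k))
  exact liminf_le_of_frequently_le'
    ((h ε (by exact_mod_cast hε)).mono fun k hk => by exact_mod_cast hk.le)

end Analysis

/-! ### Constraint violation and criticality -/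

section Constraints

variable {n m₁ m₂ : ℕ}

lemma supNorm_nonneg (p : Vec n) : 0 ≤ supNorm p := norm_nonneg _

lemma supNorm_zero : supNorm (0 : Vec n) = 0 := by simp [supNorm]

lemma supNorm_le_norm (p : Vec n) : supNorm p ≤ ‖p‖ :=
  (pi_norm_le_iff_of_nonneg (norm_nonneg _)).2 fun i => PiLp.norm_apply_le p i

lemma norm_le_supNorm (p : Vec n) : ‖p‖ ≤ √n * supNorm p := by
  rw [EuclideanSpace.norm_eq]
  refine Real.sqrt_le_iff.2 ⟨mul_nonneg (Real.sqrt_nonneg _) (supNorm_nonneg p), ?_⟩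
  rw [mul_pow, Real.sq_sqrt (Nat.cast_nonneg n)]
  calc ∑ i, ‖p i‖ ^ 2 ≤ ∑ _i : Fin n, supNorm p ^ 2 :=
        Finset.sum_le_sum fun i _ =>
          pow_le_pow_left₀ (norm_nonneg _) (norm_le_pi_norm (WithLp.ofLp p) i) 2
    _ = n * supNorm p ^ 2 := by simp

lemma norm_le_of_supNorm_le {p : Vec n} {σ : ℝ} (hp : supNorm p ≤ σ) : ‖p‖ ≤ √n * σ :=
  (norm_le_supNorm p).trans (by gcongr)

lemma supNorm_add_le (p q : Vec n) : supNorm (p + q) ≤ supNorm p + supNorm q := by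
  simpa [supNorm] using norm_add_le (WithLp.ofLp p) (WithLp.ofLp q)

lemma supNorm_smul (s : ℝ) (p : Vec n) : supNorm (s • p) = |s| * supNorm p := by
  simp [supNorm, norm_smul]

lemma continuous_supNorm : Continuous (supNorm : Vec n → ℝ) :=
  (PiLp.continuous_ofLp 2 _).norm

lemma isCompact_supNorm_le (σ : ℝ) : IsCompact {p : Vec n | supNorm p ≤ σ} :=
  Metric.isCompact_of_isClosed_isBounded (isClosed_le continuous_supNorm continuous_const)
    (Metric.isBounded_closedBall.subset fun _ hp =>
      mem_closedBall_zero_iff.2 (norm_le_of_supNorm_le hp))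

lemma setOf_supNorm_le_eq_image {σ : ℝ} (hσ : 0 ≤ σ) :
    {p : Vec n | supNorm p ≤ σ} = (fun q => σ • q) '' {q | supNorm q ≤ 1} := by
  ext p
  constructor
  · intro hp
    rcases hσ.eq_or_lt with rfl | h
    · have hp0 : p = 0 := norm_le_zero_iff.1 (by simpa using norm_le_of_supNorm_le hp)
      exact ⟨0, by simp [supNorm_zero], by simp [hp0]⟩
    · refine ⟨σ⁻¹ • p, ?_, smul_inv_smul₀ h.ne' p⟩
      rw [Set.mem_ofPred_eq, supNorm_smul, abs_of_pos (inv_pos.2 h), inv_mul_le_iff₀ h, mul_one]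
      exact hp
  · rintro ⟨q, hq, rfl⟩
    rw [Set.mem_ofPred_eq, supNorm_smul, abs_of_nonneg hσ]
    exact mul_le_of_le_one_right hσ hq

lemma zero_mem_coneK : (0 : (Fin m₁ → ℝ) × (Fin m₂ → ℝ)) ∈ coneK m₁ m₂ := by
  simp [coneK]

lemma isClosed_coneK : IsClosed (coneK m₁ m₂) := by
  rw [show coneK m₁ m₂ = {y | y.1 = 0} ∩ ⋂ j, {y | y.2 j ≤ 0} by ext; simp [coneK]]
  exact (isClosed_eq continuous_fst continuous_const).inter
    (isClosed_iInter fun j => isClosed_le (by fun_prop) continuous_const)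

lemma infDist_coneK_le_iff {y : (Fin m₁ → ℝ) × (Fin m₂ → ℝ)} {r : ℝ} (hr : 0 ≤ r) :
    Metric.infDist y (coneK m₁ m₂) ≤ r ↔ (∀ i, |y.1 i| ≤ r) ∧ ∀ j, y.2 j ≤ r := by
  constructor
  · intro h
    obtain ⟨w, hw, hwd⟩ := isClosed_coneK.exists_infDist_eq_dist ⟨_, zero_mem_coneK⟩ y
    rw [hwd, Prod.dist_eq, max_le_iff, dist_pi_le_iff hr, dist_pi_le_iff hr] at h
    refine ⟨fun i => by simpa [hw.1, Real.dist_eq] using h.1 i, fun j => ?_⟩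
    have := (le_abs_self _).trans (h.2 j)
    linarith [hw.2 j]
  · rintro ⟨h₁, h₂⟩
    have hw : ((0 : Fin m₁ → ℝ), fun j => min (y.2 j) 0) ∈ coneK m₁ m₂ :=
      ⟨rfl, fun j => min_le_right _ _⟩
    refine (Metric.infDist_le_dist_of_mem hw).trans ?_
    rw [Prod.dist_eq, max_le_iff, dist_pi_le_iff hr, dist_pi_le_iff hr]
    refine ⟨fun i => by simpa [Real.dist_eq] using h₁ i, fun j => ?_⟩
    rw [Real.dist_eq, abs_of_nonneg (sub_nonneg.2 (min_le_left _ _)), sub_le_iff_le_add,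
      ← sub_le_iff_le_add', le_min_iff]
    constructor <;> linarith [h₂ j]

namespace Problem

variable (P : Problem n m₁ m₂) {x p y : Vec n} {r σ : ℝ} {L G : ℝ≥0}

lemma phi_nonneg (x : Vec n) : 0 ≤ P.phi x := Metric.infDist_nonneg

lemma linPhi_nonneg (x p : Vec n) : 0 ≤ P.linPhi x p := Metric.infDist_nonneg

lemma phi_le_iff (hr : 0 ≤ r) :
    P.phi x ≤ r ↔ (∀ i, |P.h i x| ≤ r) ∧ ∀ j, P.c j x ≤ r :=
  infDist_coneK_le_iff hr

lemma linPhi_le_iff (hr : 0 ≤ r) :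
    P.linPhi x p ≤ r ↔ (∀ i, |P.h i x + ⟪∇ (P.h i) x, p⟫| ≤ r) ∧
      ∀ j, P.c j x + ⟪∇ (P.c j) x, p⟫ ≤ r :=
  infDist_coneK_le_iff hr

lemma abs_h_le_phi (x : Vec n) (i : Fin m₁) : |P.h i x| ≤ P.phi x :=
  ((P.phi_le_iff (P.phi_nonneg x)).1 le_rfl).1 i

lemma c_le_phi (x : Vec n) (j : Fin m₂) : P.c j x ≤ P.phi x :=
  ((P.phi_le_iff (P.phi_nonneg x)).1 le_rfl).2 j

lemma abs_h_add_le_linPhi (x p : Vec n) (i : Fin m₁) :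
    |P.h i x + ⟪∇ (P.h i) x, p⟫| ≤ P.linPhi x p :=
  ((P.linPhi_le_iff (P.linPhi_nonneg x p)).1 le_rfl).1 i

lemma c_add_le_linPhi (x p : Vec n) (j : Fin m₂) :
    P.c j x + ⟪∇ (P.c j) x, p⟫ ≤ P.linPhi x p :=
  ((P.linPhi_le_iff (P.linPhi_nonneg x p)).1 le_rfl).2 j

lemma linPhi_smul_le {s : ℝ} (hs₀ : 0 ≤ s) (hs₁ : s ≤ 1) :
    P.linPhi x (s • p) ≤ (1 - s) * P.phi x + s * P.linPhi x p := by
  have hs : 0 ≤ 1 - s := sub_nonneg.2 hs₁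
  refine (P.linPhi_le_iff (add_nonneg (mul_nonneg hs (P.phi_nonneg x))
    (mul_nonneg hs₀ (P.linPhi_nonneg x p)))).2 ⟨fun i => ?_, fun j => ?_⟩
  · calc |P.h i x + ⟪∇ (P.h i) x, s • p⟫|
        = |(1 - s) * P.h i x + s * (P.h i x + ⟪∇ (P.h i) x, p⟫)| := by
          rw [inner_smul_right]; ring_nf
      _ ≤ |(1 - s) * P.h i x| + |s * (P.h i x + ⟪∇ (P.h i) x, p⟫)| := abs_add_le _ _
      _ ≤ (1 - s) * P.phi x + s * P.linPhi x p := by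
          rw [abs_mul, abs_mul, abs_of_nonneg hs, abs_of_nonneg hs₀]
          gcongr
          exacts [P.abs_h_le_phi x i, P.abs_h_add_le_linPhi x p i]
  · calc P.c j x + ⟪∇ (P.c j) x, s • p⟫
        = (1 - s) * P.c j x + s * (P.c j x + ⟪∇ (P.c j) x, p⟫) := by
          rw [inner_smul_right]; ring
      _ ≤ (1 - s) * P.phi x + s * P.linPhi x p := by
          gcongr
          exacts [P.c_le_phi x j, P.c_add_le_linPhi x p j]

lemma phi_le_linPhi_add (hh : ∀ i, ‖∇ (P.h i) x‖ ≤ G) (hc : ∀ j, ‖∇ (P.c j) x‖ ≤ G) :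
    P.phi x ≤ P.linPhi x p + G * ‖p‖ := by
  have hle {w : Vec n} (hw : ‖w‖ ≤ G) : |⟪w, p⟫| ≤ G * ‖p‖ :=
    (abs_real_inner_le_norm w p).trans (by gcongr)
  refine (P.phi_le_iff (add_nonneg (P.linPhi_nonneg x p) (by positivity))).2
    ⟨fun i => ?_, fun j => ?_⟩
  · have h₁ := abs_le.1 (P.abs_h_add_le_linPhi x p i)
    have h₂ := abs_le.1 (hle (hh i))
    exact abs_le.2 ⟨by linarith, by linarith⟩
  · linarith [P.c_add_le_linPhi x p j, (abs_le.1 (hle (hc j))).1]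

lemma phi_add_le (hh : ∀ i, Differentiable ℝ (P.h i)) (hc : ∀ j, Differentiable ℝ (P.c j))
    (hhL : ∀ i, LipschitzOnWith L (∇ (P.h i)) (segment ℝ x (x + p)))
    (hcL : ∀ j, LipschitzOnWith L (∇ (P.c j)) (segment ℝ x (x + p))) :
    P.phi (x + p) ≤ P.linPhi x p + L * ‖p‖ ^ 2 := by
  have taylor {F : Vec n → ℝ} (hF : Differentiable ℝ F)
      (hL : LipschitzOnWith L (∇ F) (segment ℝ x (x + p))) :
      |F (x + p) - F x - ⟪∇ F x, p⟫| ≤ L * ‖p‖ ^ 2 := by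
    simpa using abs_sub_sub_inner_gradient_le (fun z _ => hF z) hL
  refine (P.phi_le_iff (add_nonneg (P.linPhi_nonneg x p) (by positivity))).2
    ⟨fun i => ?_, fun j => ?_⟩
  · have h₁ := abs_le.1 (P.abs_h_add_le_linPhi x p i)
    have h₂ := abs_le.1 (taylor (hh i) (hhL i))
    exact abs_le.2 ⟨by linarith, by linarith⟩
  · linarith [P.c_add_le_linPhi x p j, (abs_le.1 (taylor (hc j) (hcL j))).2]

lemma kappa_nonneg (x : Vec n) (σ : ℝ) : 0 ≤ P.kappa x σ :=
  Real.sInf_nonneg (Set.forall_mem_image.2 fun p _ => P.linPhi_nonneg x p)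

lemma kappa_le_linPhi (hp : supNorm p ≤ σ) : P.kappa x σ ≤ P.linPhi x p :=
  csInf_le ⟨0, Set.forall_mem_image.2 fun p _ => P.linPhi_nonneg x p⟩ ⟨p, hp, rfl⟩

lemma continuous_linPhi {X : Type*} [TopologicalSpace X] (hh : ∀ i, ContDiff ℝ 1 (P.h i))
    (hc : ∀ j, ContDiff ℝ 1 (P.c j)) {u v : X → Vec n} (hu : Continuous u) (hv : Continuous v) :
    Continuous fun z => P.linPhi (u z) (v z) := by
  refine (Metric.continuous_infDist_pt _).comp
    ((continuous_pi fun i => ?_).prodMk (continuous_pi fun j => ?_))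
  · exact ((hh i).continuous.comp hu).add (((continuous_gradient (hh i)).comp hu).inner hv)
  · exact ((hc j).continuous.comp hu).add (((continuous_gradient (hc j)).comp hu).inner hv)

lemma continuous_phi (hh : ∀ i, Continuous (P.h i)) (hc : ∀ j, Continuous (P.c j)) :
    Continuous P.phi :=
  (Metric.continuous_infDist_pt _).comp ((continuous_pi hh).prodMk (continuous_pi hc))

lemma continuous_linPhi_right (x : Vec n) : Continuous (P.linPhi x) :=
  (Metric.continuous_infDist_pt _).comp (by fun_prop)

lemma exists_linPhi_eq_kappa (x : Vec n) (hσ : 0 ≤ σ) :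
    ∃ p, supNorm p ≤ σ ∧ P.linPhi x p = P.kappa x σ := by
  obtain ⟨p, hp, h⟩ := (isCompact_supNorm_le (n := n) σ).exists_sInf_image_eq
    ⟨0, by simpa [supNorm_zero] using hσ⟩ (P.continuous_linPhi_right x).continuousOn
  exact ⟨p, hp, h.symm⟩

lemma mem_qpFeasible_iff {κ β : ℝ} (hκ : 0 ≤ κ) :
    p ∈ P.qpFeasible x κ β ↔ P.linPhi x p ≤ κ ∧ supNorm p ≤ β := by
  simp only [qpFeasible, Set.mem_ofPred_eq, P.linPhi_le_iff hκ, abs_le, and_assoc]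

lemma continuous_deltaPhi (hh : ∀ i, ContDiff ℝ 1 (P.h i)) (hc : ∀ j, ContDiff ℝ 1 (P.c j))
    {σ : Vec n → ℝ} (hσ : Continuous σ) (hσ₀ : ∀ x, 0 ≤ σ x) :
    Continuous fun x => P.deltaPhi x (σ x) := by
  -- rescaling the infimum to the fixed compact set `‖q‖_∞ ≤ 1` makes it continuous in `x`
  have hkappa (x : Vec n) :
      P.kappa x (σ x) = sInf ((fun q => P.linPhi x (σ x • q)) '' {q | supNorm q ≤ 1}) := by
    rw [kappa, setOf_supNorm_le_eq_image (hσ₀ x), Set.image_image]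
  simp only [deltaPhi, hkappa]
  refine (P.continuous_phi (fun i => (hh i).continuous) fun j => (hc j).continuous).sub
    ((isCompact_supNorm_le 1).continuous_sInf (f := fun x q => P.linPhi x (σ x • q)) ?_)
  exact P.continuous_linPhi hh hc continuous_fst ((hσ.comp continuous_fst).smul continuous_snd)

lemma chi_nonneg {βl : ℝ} (hβ : 0 ≤ βl) (x : Vec n) : 0 ≤ P.chi βl x :=
  neg_nonneg.2 (Real.sInf_nonpos'
    ⟨0, ⟨0, by simp [supNorm_zero, div_nonneg hβ zero_le_two], inner_zero_right _⟩, le_rfl⟩)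

lemma chi_le_of_forall {βl : ℝ} (hβ : 0 ≤ βl) (h : ∀ t, (∀ i, ⟪∇ (P.h i) x, t⟫ = 0) →
    (∀ j, ⟪∇ (P.c j) x, t⟫ ≤ 0) → supNorm t ≤ βl / 2 → -r ≤ ⟪∇ P.f x, t⟫) :
    P.chi βl x ≤ r :=
  neg_le.1 (le_csInf ⟨0, 0, by simp [supNorm_zero, div_nonneg hβ zero_le_two], inner_zero_right _⟩
    (Set.forall_mem_image.2 fun t ht => h t ht.1 ht.2.1 ht.2.2))

variable {P}

lemma EMFCQ.exists_inner_eq (hy : P.EMFCQ y) :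
    ∃ C > 0, ∀ (v : Fin m₁ → ℝ) (r : ℝ), 0 ≤ r → (∀ i, |v i| ≤ r) → ∃ u, ‖u‖ ≤ C * r ∧
      (∀ i, ⟪∇ (P.h i) y, u⟫ = v i) ∧ ∀ j, 0 ≤ P.c j y → ⟪∇ (P.c j) y, u⟫ ≤ -r := by
  obtain ⟨hli, z, hz, hzc⟩ := hy
  obtain ⟨b, hb⟩ := exists_biorthogonal hli
  set B := ∑ i, ‖b i‖
  obtain ⟨t, ht, htz⟩ : ∃ t ≥ (0 : ℝ), ∀ j, 0 ≤ P.c j y →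
      t * ⟪∇ (P.c j) y, z⟫ ≤ -1 - ‖∇ (P.c j) y‖ * B := by
    refine ((eventually_ge_atTop 0).and (eventually_all.2 fun j => ?_)).exists
    by_cases hj : 0 ≤ P.c j y
    · filter_upwards [(tendsto_id.atTop_mul_const_of_neg (hzc j hj)).eventually_le_atBot
        (-1 - ‖∇ (P.c j) y‖ * B)] with t ht _ using ht
    · exact .of_forall fun _ h => absurd h hj
  refine ⟨B + t * ‖z‖ + 1, by positivity, fun v r hr hv => ?_⟩
  set q := ∑ i, v i • b i
  have hq : ‖q‖ ≤ r * B := by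
    rw [Finset.mul_sum]
    refine norm_sum_le_of_le _ fun i _ => ?_
    rw [norm_smul, Real.norm_eq_abs]
    exact mul_le_mul_of_nonneg_right (hv i) (norm_nonneg _)
  refine ⟨q + (r * t) • z, ?_, fun i => ?_, fun j hj => ?_⟩
  · have h := norm_add_le q ((r * t) • z)
    rw [norm_smul, Real.norm_of_nonneg (mul_nonneg hr ht)] at h
    linarith
  · rw [inner_add_right, inner_smul_right, hz i, inner_sum]
    simp [inner_smul_right, hb]
  · have h₁ : ⟪∇ (P.c j) y, q⟫ ≤ ‖∇ (P.c j) y‖ * (r * B) :=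
      (real_inner_le_norm _ _).trans (by gcongr)
    have h₂ := mul_le_mul_of_nonneg_left (htz j hj) hr
    rw [inner_add_right, inner_smul_right]
    linarith

lemma EMFCQ.exists_halving_step (hh : ∀ i, ContDiff ℝ 1 (P.h i)) (hc : ∀ j, ContDiff ℝ 1 (P.c j))
    (hy : P.EMFCQ y) :
    ∃ C, ∀ᶠ x in 𝓝 y, ∃ u, ‖u‖ ≤ C * P.phi x ∧
      (∀ i, |P.h i x + ⟪∇ (P.h i) x, u⟫| ≤ P.phi x / 2) ∧
      ∀ j, 0 ≤ P.c j y → P.c j x + ⟪∇ (P.c j) x, u⟫ ≤ P.phi x / 2 := by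
  obtain ⟨C, hC, hstep⟩ := hy.exists_inner_eq
  have near {F : Vec n → ℝ} (hF : ContDiff ℝ 1 F) :
      ∀ᶠ x in 𝓝 y, ‖∇ F x - ∇ F y‖ < 1 / (2 * C) := by
    simpa only [dist_eq_norm] using
      Metric.tendsto_nhds.1 (continuous_gradient hF).continuousAt (1 / (2 * C)) (by positivity)
  refine ⟨C, ?_⟩
  filter_upwards [eventually_all.2 fun i => near (hh i), eventually_all.2 fun j => near (hc j)]
    with x hxh hxc
  obtain ⟨u, hu, huh, huc⟩ := hstep (fun i => -P.h i x) (P.phi x) (P.phi_nonneg x)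
    fun i => by simpa using P.abs_h_le_phi x i
  have hpert {v w : Vec n} (hvw : ‖v - w‖ < 1 / (2 * C)) : |⟪v, u⟫ - ⟪w, u⟫| ≤ P.phi x / 2 := by
    calc |⟪v, u⟫ - ⟪w, u⟫| = |⟪v - w, u⟫| := by rw [inner_sub_left]
      _ ≤ ‖v - w‖ * ‖u‖ := abs_real_inner_le_norm _ _
      _ ≤ 1 / (2 * C) * (C * P.phi x) := by gcongr
      _ = P.phi x / 2 := by field_simp
  refine ⟨u, hu, fun i => ?_, fun j hj => ?_⟩
  · simpa [huh, add_comm] using hpert (hxh i)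
  · linarith [huc j hj, (abs_le.1 (hpert (hxc j))).2, P.c_le_phi x j]

lemma linPhi_smul_le_of_halving {s : ℝ} {u : Vec n} (hs₀ : 0 ≤ s) (hs₁ : s ≤ 1)
    (hu : ∀ i, |P.h i x + ⟪∇ (P.h i) x, u⟫| ≤ P.phi x / 2)
    (hc : ∀ j, P.c j x + ⟪∇ (P.c j) x, u⟫ ≤ P.phi x / 2 ∨
      P.c j x + s * ⟪∇ (P.c j) x, u⟫ ≤ 0) :
    P.linPhi x (s • u) ≤ (1 - s / 2) * P.phi x := by
  have hr : 0 ≤ (1 - s / 2) * P.phi x := mul_nonneg (by linarith) (P.phi_nonneg x)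
  refine (P.linPhi_le_iff hr).2 ⟨fun i => ?_, fun j => ?_⟩ <;> rw [inner_smul_right]
  · have h₁ := abs_le.1 (hu i)
    have h₂ := abs_le.1 (P.abs_h_le_phi x i)
    rw [abs_le]
    constructor <;> nlinarith
  · rcases hc j with hj | hj
    · nlinarith [P.c_le_phi x j]
    · linarith

lemma EMFCQ.exists_le_deltaPhi (hh : ∀ i, ContDiff ℝ 1 (P.h i)) (hc : ∀ j, ContDiff ℝ 1 (P.c j))
    (hy : P.EMFCQ y) {σu κu : ℝ} (hσu : 0 < σu) (hκu : 0 < κu) :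
    ∃ b > 0, ∀ᶠ x in 𝓝 y, b * P.phi x ≤ P.deltaPhi x (min σu (κu * P.phi x)) := by
  obtain ⟨C, hstep⟩ := hy.exists_halving_step hh hc
  have hphi : ContinuousAt (fun x => C * P.phi x) y :=
    ((P.continuous_phi (fun i => (hh i).continuous) fun j => (hc j).continuous).const_mul
      C).continuousAt
  have hinactive (j : Fin m₂) : ∀ᶠ s in 𝓝 (0 : ℝ), P.c j y < 0 → ∀ᶠ x in 𝓝 y,
      P.c j x + s * (‖∇ (P.c j) x‖ * (C * P.phi x)) ≤ 0 := by
    by_cases h : P.c j y < 0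
    · exact (eventually_eventually_add_mul_le (hc j).continuous.continuousAt
        ((continuous_gradient (hc j)).norm.continuousAt.mul hphi) h).mono fun _ hs _ => hs
    · exact .of_forall fun _ h' => absurd h' h
  have hsmall : ∀ᶠ s in 𝓝 (0 : ℝ), (s ≤ 1 ∧ s * C ≤ κu) ∧
      (∀ᶠ x in 𝓝 y, 0 + s * (C * P.phi x) ≤ σu) ∧ ∀ j, P.c j y < 0 → ∀ᶠ x in 𝓝 y,
        P.c j x + s * (‖∇ (P.c j) x‖ * (C * P.phi x)) ≤ 0 :=
    ((eventually_le_nhds one_pos).and (((continuous_mul_const C).tendsto 0).eventually_le_const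
      (by simpa using hκu))).and ((eventually_eventually_add_mul_le continuousAt_const hphi
        hσu).and (eventually_all.2 hinactive))
  obtain ⟨s, ⟨⟨hs₁, hsC⟩, htrust, hinactive⟩, hs₀ : 0 < s⟩ :=
    ((hsmall.filter_mono nhdsWithin_le_nhds).and
      (self_mem_nhdsWithin (a := (0 : ℝ)) (s := Set.Ioi 0))).exists
  refine ⟨s / 2, by positivity, ?_⟩
  filter_upwards [htrust, eventually_all.2 fun j => eventually_imp_distrib_left.2 (hinactive j),
    hstep] with x hσ hin ⟨u, hu, huh, huc⟩
  have hsup : supNorm (s • u) ≤ min σu (κu * P.phi x) := by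
    have hle : supNorm (s • u) ≤ s * (C * P.phi x) := by
      rw [supNorm_smul, abs_of_pos hs₀]
      exact mul_le_mul_of_nonneg_left ((supNorm_le_norm u).trans hu) hs₀.le
    refine le_min (by linarith) (hle.trans ?_)
    rw [← mul_assoc]
    exact mul_le_mul_of_nonneg_right hsC (P.phi_nonneg x)
  have hlin := linPhi_smul_le_of_halving hs₀.le hs₁ huh fun j => (le_or_gt 0 (P.c j y)).imp
    (huc j) fun hj => (add_le_add_right (mul_le_mul_of_nonneg_left
      ((real_inner_le_norm _ _).trans (by gcongr)) hs₀.le) _).trans (hin j hj)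
  rw [deltaPhi]
  linarith [P.kappa_le_linPhi (x := x) hsup]

end Problem

end Constraints

/-! ### Walks and runs of random events -/

section Probability

variable {S : Type*} {m₀ : MeasurableSpace S} {μ : Measure S} [IsFiniteMeasure μ]
  {ℱ : Filtration ℕ m₀} {B G : ℕ → Set S} {p q : ℝ} {ω : S}

/-- The events `G`, the `k`-th of which is decided at time `k + 1`, indexed by the time at which
they are decided. -/
def delayed (G : ℕ → Set S) : ℕ → Set S
  | 0 => ∅
  | k + 1 => G k

lemma measurableSet_delayed (hG : ∀ k, MeasurableSet[ℱ (k + 1)] (G k)) :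
    ∀ k, MeasurableSet[ℱ k] (delayed G k)
  | 0 => @MeasurableSet.empty _ (ℱ 0)
  | k + 1 => hG k

lemma frequently_mem_delayed_and_iff {r : ℕ → Prop} :
    (∃ᶠ k in atTop, ω ∈ delayed G k ∧ r k) ↔ ∃ᶠ k in atTop, ω ∈ G k ∧ r (k + 1) := by
  conv_lhs => rw [← map_add_atTop_eq_nat 1, frequently_map]
  rfl

lemma frequently_mem_delayed_iff :
    (∃ᶠ k in atTop, ω ∈ delayed G k) ↔ ∃ᶠ k in atTop, ω ∈ G k := by
  simpa using frequently_mem_delayed_and_iff (ω := ω) (G := G) (r := fun _ => True)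

/-- The walk that moves by `1 - q` at the times `k` at which `G k` occurs and by `-q` at the other
times, after `N` steps. -/
noncomputable def walk (G : ℕ → Set S) (q : ℝ) (N : ℕ) (ω : S) : ℝ :=
  ∑ k ∈ Finset.range N, ((G k).indicator (fun _ => (1 : ℝ)) ω - q)

lemma walk_succ_of_mem {N : ℕ} (h : ω ∈ G N) : walk G q (N + 1) ω = walk G q N ω + (1 - q) := by
  rw [walk, Finset.sum_range_succ, Set.indicator_of_mem h, walk]

lemma walk_succ_of_notMem {N : ℕ} (h : ω ∉ G N) : walk G q (N + 1) ω = walk G q N ω - q := by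
  rw [walk, Finset.sum_range_succ, Set.indicator_of_notMem h, zero_sub, walk, sub_eq_add_neg]

/-- The martingale part of the number of events has bounded increments, so it almost surely does not
tend to `-∞`; it would if the walk were bounded above. -/
lemma ae_not_bddAbove_walk (hG : ∀ k, MeasurableSet[ℱ (k + 1)] (G k)) (hqp : q < p)
    (hp : ∀ k, ∀ᵐ ω ∂μ, p ≤ (μ⟦G k | ℱ k⟧) ω) :
    ∀ᵐ ω ∂μ, ¬ BddAbove (Set.range fun N => walk G q N ω) := by
  set X : ℕ → S → ℝ := BorelCantelli.process (delayed G)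
  have hincr : ∀ᵐ ω ∂μ, ∀ i, ‖X (i + 1) ω - X i ω‖ ≤ (1 : ℝ) :=
    .of_forall fun ω i => by simpa using BorelCantelli.process_difference_le (delayed G) ω i
  have hmart := (martingale_martingalePart
    (BorelCantelli.stronglyAdapted_process (measurableSet_delayed hG))
    (BorelCantelli.integrable_process μ (measurableSet_delayed hG))).ae_not_tendsto_atTop_atBot
      (R := 2) (by simpa [Real.norm_eq_abs] using martingalePart_bdd_difference ℱ hincr)
  filter_upwards [hmart, ae_all_iff.2 hp] with ω hω hpω
  rintro ⟨b, hb⟩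
  have hlim : Tendsto (fun N : ℕ => b + (N : ℝ) * (q - p)) atTop atBot :=
    tendsto_atBot_add_const_left _ _
      (tendsto_natCast_atTop_atTop.atTop_mul_const_of_neg (sub_neg.2 hqp))
  refine hω (tendsto_atBot_mono (fun N => ?_) hlim)
  calc martingalePart X ℱ μ N ω
      = ∑ k ∈ Finset.range N, ((G k).indicator (fun _ => (1 : ℝ)) ω - (μ⟦G k | ℱ k⟧) ω) := by
        rw [BorelCantelli.martingalePart_process_ae_eq, Finset.sum_apply]
        rfl
    _ ≤ ∑ k ∈ Finset.range N, ((G k).indicator (fun _ => (1 : ℝ)) ω - q + (q - p)) :=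
        Finset.sum_le_sum fun k _ => by linarith [hpω k]
    _ = walk G q N ω + N * (q - p) := by
        rw [Finset.sum_add_distrib, walk, Finset.sum_const, Finset.card_range, nsmul_eq_mul]
    _ ≤ b + N * (q - p) := by gcongr; exact hb ⟨N, rfl⟩

lemma ae_frequently_inter (hB : ∀ k, MeasurableSet[ℱ k] (B k))
    (hG : ∀ k, MeasurableSet[ℱ (k + 1)] (G k)) (hp₀ : 0 < p)
    (hp : ∀ k, ∀ᵐ ω ∂μ, p ≤ (μ⟦G k | ℱ k⟧) ω) :
    ∀ᵐ ω ∂μ, (∃ᶠ k in atTop, ω ∈ B k) → ∃ᶠ k in atTop, ω ∈ B k ∩ G k := by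
  have hBG k : MeasurableSet[ℱ (k + 1)] (B k ∩ G k) := (ℱ.mono k.le_succ _ (hB k)).inter (hG k)
  have hpull k : μ⟦B k ∩ G k | ℱ k⟧ =ᵐ[μ] (B k).indicator (μ⟦G k|ℱ k⟧) := by
    rw [← Set.indicator_indicator]
    exact condExp_indicator ((integrable_const _).indicator (ℱ.le _ _ (hG k))) (hB k)
  filter_upwards [ae_mem_limsup_atTop_iff μ (measurableSet_delayed hBG), ae_all_iff.2 hp,
    ae_all_iff.2 hpull] with ω hlevy hpω hpull hfreq
  have hsumB : Tendsto (fun N => ∑ k ∈ Finset.range N, (B k).indicator (fun _ => p) ω)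
      atTop atTop := by
    rw [← mem_limsup_iff_frequently_mem,
      Set.limsup_eq_tendsto_sum_indicator_atTop (R := ℝ) hp₀ B] at hfreq
    exact hfreq
  have hmem := hlevy.2 (tendsto_atTop_mono (fun N => Finset.sum_le_sum fun k _ => ?_) hsumB)
  · exact frequently_mem_delayed_iff.1 (mem_limsup_iff_frequently_mem.1 hmem)
  · refine le_of_le_of_eq ?_ (hpull k).symm
    by_cases hk : ω ∈ B k
    · simpa [hk] using hpω k
    · simp [hk]

lemma ae_frequently_run (N : ℕ) (hB : ∀ k, MeasurableSet[ℱ k] (B k))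
    (hG : ∀ k, MeasurableSet[ℱ (k + 1)] (G k)) (hp₀ : 0 < p)
    (hp : ∀ k, ∀ᵐ ω ∂μ, p ≤ (μ⟦G k | ℱ k⟧) ω) :
    ∀ᵐ ω ∂μ, (∃ᶠ k in atTop, ω ∈ B k) →
      ∃ᶠ k in atTop, ω ∈ B k ∧ ∀ i < N, ω ∈ G (k + i) := by
  induction N generalizing B with
  | zero => exact .of_forall fun ω h => by simpa using h
  | succ N ih =>
    have hBG k : MeasurableSet[ℱ (k + 1)] (B k ∩ G k) :=
      (ℱ.mono k.le_succ _ (hB k)).inter (hG k)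
    filter_upwards [ih (measurableSet_delayed hBG), ae_frequently_inter hB hG hp₀ hp]
      with ω hrun hinter hfreq
    have hdelayed : ∃ᶠ k in atTop, ω ∈ delayed (fun k => B k ∩ G k) k :=
      frequently_mem_delayed_iff.2 (hinter hfreq)
    refine (frequently_mem_delayed_and_iff.1 (hrun hdelayed)).mono ?_
    rintro k ⟨⟨hBk, hGk⟩, hrun⟩
    refine ⟨hBk, ?_⟩
    rintro (_ | i) hi
    · exact hGk
    · simpa only [add_assoc, add_comm 1 i] using hrun i (Nat.lt_of_succ_lt_succ hi)

lemma ae_le_condExp_inter {m m' : MeasurableSpace S} (hmm' : m ≤ m') (hm' : m' ≤ m₀)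
    {I J : Set S} (hI : MeasurableSet[m'] I) (hJ : MeasurableSet[m₀] J) (hp : 0 ≤ p)
    (hIq : ∀ᵐ ω ∂μ, q ≤ (μ⟦I | m⟧) ω) (hJp : ∀ᵐ ω ∂μ, p ≤ (μ⟦J | m'⟧) ω) :
    ∀ᵐ ω ∂μ, p * q ≤ (μ⟦I ∩ J | m⟧) ω := by
  have hIi : Integrable (I.indicator fun _ => (1 : ℝ)) μ :=
    (integrable_const _).indicator (hm' _ hI)
  have hJi : Integrable (J.indicator fun _ => (1 : ℝ)) μ := (integrable_const _).indicator hJ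
  have hpull : μ⟦I ∩ J | m'⟧ =ᵐ[μ] I.indicator (μ⟦J | m'⟧) := by
    rw [← Set.indicator_indicator]
    exact condExp_indicator hJi hI
  have hle : p • I.indicator (fun _ => (1 : ℝ)) ≤ᵐ[μ] μ⟦I ∩ J | m'⟧ := by
    filter_upwards [hpull, hJp] with ω hpull hJp
    rw [hpull]
    by_cases hω : ω ∈ I
    · simpa [hω] using hJp
    · simp [hω]
  filter_upwards [condExp_mono (m := m) (hIi.smul p) integrable_condExp hle,
    condExp_condExp_of_le (f := (I ∩ J).indicator fun _ => (1 : ℝ)) (μ := μ) hmm' hm',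
    condExp_smul (μ := μ) p (I.indicator fun _ => (1 : ℝ)) m, hIq] with ω hmono htower hsmul hq
  rw [htower, hsmul] at hmono
  exact (mul_le_mul_of_nonneg_left hq hp).trans hmono

lemma frequently_le_of_not_bddAbove_walk {γ a : ℝ} (hγ : 1 < γ) {α : ℕ → ℝ} (hα : ∀ k, 0 < α k)
    (hlow : ∀ k, γ⁻¹ * α k ≤ α (k + 1))
    (hG : ∀ᶠ k in atTop, ω ∈ G k → α k < a → γ * α k ≤ α (k + 1))
    (hwalk : ¬ BddAbove (Set.range fun N => walk G (1 / 2) N ω)) :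
    ∃ᶠ k in atTop, a ≤ α k := by
  by_contra h
  simp only [not_frequently, not_le] at h
  obtain ⟨K, hK⟩ := eventually_atTop.1 (hG.and h)
  have hγ₀ := one_pos.trans hγ
  have hmono : ∀ k ≥ K, Real.logb γ (α K) - 2 * walk G (1 / 2) K ω ≤
      Real.logb γ (α k) - 2 * walk G (1 / 2) k ω := by
    refine Nat.le_induction le_rfl fun k hk ih => ih.trans ?_
    by_cases hGk : ω ∈ G k
    · have := Real.logb_le_logb_of_le hγ (by have := hα k; positivity) ((hK k hk).1 hGk (hK k hk).2)
      rw [Real.logb_mul hγ₀.ne' (hα k).ne', Real.logb_self_eq_one hγ] at this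
      rw [walk_succ_of_mem hGk]
      linarith
    · have := Real.logb_le_logb_of_le hγ (by have := hα k; positivity) (hlow k)
      rw [Real.logb_mul (inv_ne_zero hγ₀.ne') (hα k).ne', Real.logb_inv,
        Real.logb_self_eq_one hγ] at this
      rw [walk_succ_of_notMem hGk]
      linarith
  refine hwalk (IsBoundedUnder.bddAbove_range
    ⟨(Real.logb γ a - Real.logb γ (α K) + 2 * walk G (1 / 2) K ω) / 2, eventually_map.2 ?_⟩)
  filter_upwards [eventually_ge_atTop K] with k hk
  have := Real.logb_le_logb_of_le hγ (hα k) (hK k hk).2.le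
  linarith [hmono k hk]

end Probability

/-! ### Backtracking step sizes -/

section DescentStep

variable {γ D a b m αmax M : ℝ} {V α : ℕ → ℝ} {k N : ℕ}

/-- The step from `k` to `k + 1` of a backtracking line search with merit values `V` and step sizes
`α` either decreases `V` by at least `D * α k` and does not decrease the step size, or leaves `V` as
it was and reduces a step size larger than `a`. -/
def DescentStep (γ D a : ℝ) (V α : ℕ → ℝ) (k : ℕ) : Prop :=
  (V (k + 1) ≤ V k - D * α k ∧ α k ≤ α (k + 1) ∧ α (k + 1) ≤ γ * α k) ∨
    (V (k + 1) = V k ∧ α (k + 1) = γ⁻¹ * α k ∧ a < α k)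

lemma DescentStep.le_step (hγ : 1 < γ) (h : DescentStep γ D a V α k) (hm : m ≤ α k)
    (hma : m ≤ γ⁻¹ * a) : m ≤ α (k + 1) := by
  rcases h with ⟨-, hα, -⟩ | ⟨-, hα, ha⟩
  · exact hm.trans hα
  · rw [hα]
    exact hma.trans (by gcongr)

lemma DescentStep.potential_le (hγ : 1 < γ) (hD : 0 < D) (h : DescentStep γ D a V α k)
    (hm₀ : 0 < m) (hm : m ≤ α k) :
    2 / (D * m) * V (k + 1) + Real.logb γ (α (k + 1)) ≤
      2 / (D * m) * V k + Real.logb γ (α k) - 1 := by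
  have hγ₀ := one_pos.trans hγ
  have hα₀ := hm₀.trans_le hm
  rcases h with ⟨hV, hα₁, hα₂⟩ | ⟨hV, hα, -⟩
  · have hlog := Real.logb_le_logb_of_le hγ (hα₀.trans_le hα₁) hα₂
    rw [Real.logb_mul hγ₀.ne' hα₀.ne', Real.logb_self_eq_one hγ] at hlog
    have hdrop : 2 / (D * m) * V (k + 1) ≤ 2 / (D * m) * V k - 2 := calc
      2 / (D * m) * V (k + 1) ≤ 2 / (D * m) * (V k - D * m) := by
        gcongr
        exact hV.trans (by gcongr)
      _ = 2 / (D * m) * V k - 2 := by field_simp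
    linarith
  · rw [hV, hα, Real.logb_mul (inv_ne_zero hγ₀.ne') hα₀.ne', Real.logb_inv,
      Real.logb_self_eq_one hγ]
    linarith

lemma potential_le_of_descentSteps (hγ : 1 < γ) (hD : 0 < D) (hm₀ : 0 < m) (hma : m ≤ γ⁻¹ * a)
    (hm : m ≤ α k) (h : ∀ i < N, DescentStep γ D a V α (k + i)) :
    m ≤ α (k + N) ∧ 2 / (D * m) * V (k + N) + Real.logb γ (α (k + N)) ≤
      2 / (D * m) * V k + Real.logb γ (α k) - N := by
  induction N with
  | zero => simpa using hm
  | succ N ih =>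
    obtain ⟨hα, hV⟩ := ih fun i hi => h i (by omega)
    have hN := h N N.lt_succ_self
    refine ⟨hN.le_step hγ hα hma, ?_⟩
    have := hN.potential_le hγ hD hm₀ hα
    push_cast
    rw [← add_assoc]
    linarith

lemma exists_not_forall_descentStep (hγ : 1 < γ) (hD : 0 < D) (ha : 0 < a) (hb : 0 < b)
    (hα : ∀ k, α k ≤ αmax) (hV : ∀ k, |V k| ≤ M) :
    ∃ N, ∀ k, b ≤ α k → ¬ ∀ i < N, DescentStep γ D a V α (k + i) := by
  set m := min b (γ⁻¹ * a)
  have hm₀ : 0 < m := lt_min hb (by positivity)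
  obtain ⟨N, hN⟩ :=
    exists_nat_gt (2 / (D * m) * (2 * M) + (Real.logb γ αmax - Real.logb γ m))
  refine ⟨N, fun k hk h => ?_⟩
  have hmk : m ≤ α k := (min_le_left _ _).trans hk
  obtain ⟨hmN, hpot⟩ := potential_le_of_descentSteps hγ hD hm₀ (min_le_right _ _) hmk h
  have hlog₁ := Real.logb_le_logb_of_le hγ hm₀ hmN
  have hlog₂ := Real.logb_le_logb_of_le hγ (hm₀.trans_le hmk) (hα k)
  have hVdiff : 2 / (D * m) * (V k - V (k + N)) ≤ 2 / (D * m) * (2 * M) := by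
    gcongr
    linarith [abs_le.1 (hV k), abs_le.1 (hV (k + N))]
  linarith

end DescentStep

/-! ### Measurability of the iterates -/

section Measurability

variable {n m₁ m₂ : ℕ} {S : Type*}

lemma measurable_quadForm {_ : MeasurableSpace S} {H : S → Matrix (Fin n) (Fin n) ℝ}
    {d : S → Vec n} (hH : ∀ p q, Measurable fun ω => H ω p q) (hd : Measurable d) :
    Measurable fun ω => quadForm (H ω) (d ω) := by
  have hdi (i : Fin n) : Measurable fun ω => d ω i :=
    (measurable_pi_apply i).comp ((PiLp.continuous_ofLp 2 _).measurable.comp hd)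
  simp only [quadForm, dotProduct, Matrix.mulVec]
  exact Finset.measurable_sum _ fun i _ => (hdi i).mul
    (Finset.measurable_sum _ fun j _ => (hH i j).mul (hdi j))

namespace Run

section Past

variable (R : Run n S) (k : ℕ)

lemma past_le_past_succ : R.past k ≤ R.past (k + 1) :=
  iSup_le fun i => le_iSup_of_le i.castSucc le_rfl

lemma past_le_halfPast : R.past k ≤ R.halfPast k := le_sup_left

lemma comap_le_past_succ :
    MeasurableSpace.comap (R.g k) inferInstance ⊔ MeasurableSpace.comap (R.f0 k) inferInstance ⊔
      MeasurableSpace.comap (R.fs k) inferInstance ≤ R.past (k + 1) :=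
  le_iSup_of_le (Fin.last k) le_rfl

lemma halfPast_le_past_succ : R.halfPast k ≤ R.past (k + 1) :=
  sup_le (R.past_le_past_succ k) ((le_sup_left.trans le_sup_left).trans (R.comap_le_past_succ k))

lemma measurable_g : Measurable[R.halfPast k] (R.g k) :=
  measurable_iff_comap_le.2 le_sup_right

lemma measurable_f0 : Measurable[R.past (k + 1)] (R.f0 k) :=
  measurable_iff_comap_le.2 ((le_sup_right.trans le_sup_left).trans (R.comap_le_past_succ k))

lemma measurable_fs : Measurable[R.past (k + 1)] (R.fs k) :=
  measurable_iff_comap_le.2 (le_sup_right.trans (R.comap_le_past_succ k))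

end Past

variable {R : Run n S} {P : Problem n m₁ m₂} {A : Params} {x₀ : Vec n} {k : ℕ} {κg εf : ℝ}

lemma sigma_nonneg (ω : S) : 0 ≤ R.sigma P A k ω :=
  le_min A.σu_pos.le (mul_nonneg A.κu_pos.le (P.phi_nonneg _))

lemma measurable_dPhi {_ : MeasurableSpace S} (hh : ∀ i, ContDiff ℝ 1 (P.h i))
    (hc : ∀ j, ContDiff ℝ 1 (P.c j)) (hx : Measurable (R.x k)) : Measurable (R.dPhi P A k) := by
  have hphi : Continuous P.phi :=
    P.continuous_phi (fun i => (hh i).continuous) fun j => (hc j).continuous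
  exact (P.continuous_deltaPhi hh hc (continuous_const.min (continuous_const.mul hphi)) fun x =>
    le_min A.σu_pos.le (mul_nonneg A.κu_pos.le (P.phi_nonneg x))).measurable.comp hx

lemma measurable_predRed {_ : MeasurableSpace S} (hh : ∀ i, ContDiff ℝ 1 (P.h i))
    (hc : ∀ j, ContDiff ℝ 1 (P.c j)) (hx : Measurable (R.x k)) (hg : Measurable (R.g k))
    (hd : Measurable (R.d k)) {ρ : S → ℝ} (hρ : Measurable ρ) :
    Measurable fun ω => R.predRed P A k ω (ρ ω) :=
  (hg.inner hd).neg.add (hρ.mul (measurable_dPhi hh hc hx))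

lemma measurableSet_setOf_success {_ : MeasurableSpace S} (hh : ∀ i, ContDiff ℝ 1 (P.h i))
    (hc : ∀ j, ContDiff ℝ 1 (P.c j)) (hx : Measurable (R.x k)) (hg : Measurable (R.g k))
    (hd : Measurable (R.d k)) (hα : Measurable (R.α k)) (hρ : Measurable (R.ρ (k + 1)))
    (hf0 : Measurable (R.f0 k)) (hfs : Measurable (R.fs k)) :
    MeasurableSet {ω | R.Success P A k ω} := by
  have hphi : Measurable P.phi :=
    (P.continuous_phi (fun i => (hh i).continuous) fun j => (hc j).continuous).measurable
  exact measurableSet_le ((hα.const_mul _).mul (measurable_predRed hh hc hx hg hd hρ))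
    ((hf0.add (hρ.mul (hphi.comp hx))).sub
      (hfs.add (hρ.mul (hphi.comp (hx.add (hα.smul hd))))))

lemma measurableSet_gradAcc {_ : MeasurableSpace S} (hf : ContDiff ℝ 1 P.f)
    (hx : Measurable (R.x k)) (hg : Measurable (R.g k)) (hd : Measurable (R.d k))
    (hα : Measurable (R.α k)) : MeasurableSet (R.gradAcc P κg k) :=
  measurableSet_le (hg.sub ((continuous_gradient hf).measurable.comp hx)).norm
    ((hα.const_mul κg).mul hd.norm)

lemma measurableSet_funAcc {_ : MeasurableSpace S} (hf : Measurable P.f)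
    (hx : Measurable (R.x k)) (hd : Measurable (R.d k)) (hα : Measurable (R.α k))
    (hf0 : Measurable (R.f0 k)) (hfs : Measurable (R.fs k)) :
    MeasurableSet (R.funAcc P εf k) := by
  have hrhs := ((hα.pow_const 2).const_mul εf).mul (hd.norm.pow_const 2)
  exact (measurableSet_le (Measurable.abs (hf0.sub (hf.comp hx))) hrhs).inter
    (measurableSet_le (Measurable.abs (hfs.sub (hf.comp (hx.add (hα.smul hd))))) hrhs)

namespace IsGenerated

variable [MeasurableSpace S]

open Classical in
lemma rho_succ (hR : R.IsGenerated P A x₀) (ω : S) :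
    R.ρ (k + 1) ω = if R.PenaltyOk P A k ω then R.ρ k ω else
      max (R.qpObj k ω (R.d k ω) / R.dPhi P A k ω) (2 * R.ρ k ω) := by
  split_ifs with h
  exacts [hR.penalty_keep k ω h, hR.penalty_raise k ω h]

open Classical in
lemma x_succ (hR : R.IsGenerated P A x₀) (ω : S) :
    R.x (k + 1) ω = if R.Success P A k ω then R.trial k ω else R.x k ω := by
  split_ifs with h
  exacts [(hR.success k ω h).1, (hR.failure k ω h).1]

open Classical in
lemma alpha_succ (hR : R.IsGenerated P A x₀) (ω : S) :
    R.α (k + 1) ω =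
      if R.Success P A k ω then min (A.γ * R.α k ω) A.αmax else A.γ⁻¹ * R.α k ω := by
  split_ifs with h
  exacts [(hR.success k ω h).2, (hR.failure k ω h).2]

lemma measurable_rho_succ (hR : R.IsGenerated P A x₀) (hh : ∀ i, ContDiff ℝ 1 (P.h i))
    (hc : ∀ j, ContDiff ℝ 1 (P.c j)) (hx : Measurable[R.past k] (R.x k))
    (hρ : Measurable[R.past k] (R.ρ k)) : Measurable[R.halfPast k] (R.ρ (k + 1)) := by
  classical
  have hle := R.past_le_halfPast k
  have hx' := hx.mono hle le_rfl
  have hρ' := hρ.mono hle le_rfl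
  have hg := R.measurable_g k
  have hd := hR.d_meas k
  have hquad := measurable_quadForm (fun p q => (hR.H_meas k p q).mono hle le_rfl) hd
  have hok : MeasurableSet[R.halfPast k] {ω | R.PenaltyOk P A k ω} :=
    measurableSet_le (hquad.div_const 2) (measurable_predRed hh hc hx' hg hd hρ')
  rw [show R.ρ (k + 1) = _ from funext fun ω => hR.rho_succ ω]
  exact Measurable.ite hok hρ' ((((hg.inner hd).add (hquad.div_const 2)).div
    (measurable_dPhi hh hc hx')).max (hρ'.const_mul 2))

lemma measurable_past (hR : R.IsGenerated P A x₀) (hh : ∀ i, ContDiff ℝ 1 (P.h i))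
    (hc : ∀ j, ContDiff ℝ 1 (P.c j)) (k : ℕ) :
    Measurable[R.past k] (R.x k) ∧ Measurable[R.past k] (R.α k) ∧
      Measurable[R.past k] (R.ρ k) := by
  classical
  induction k with
  | zero =>
    rw [show R.x 0 = fun _ => x₀ from funext hR.x_init,
      show R.α 0 = fun _ => A.γ ^ A.j0 * A.αmax from funext hR.α_init,
      show R.ρ 0 = fun _ => A.ρ0 from funext hR.ρ_init]
    exact ⟨measurable_const, measurable_const, measurable_const⟩
  | succ k ih =>
    obtain ⟨hx, hα, hρ⟩ := ih
    have hle := R.halfPast_le_past_succ k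
    have hρ' := (hR.measurable_rho_succ hh hc hx hρ).mono hle le_rfl
    have hx' := hx.mono (R.past_le_past_succ k) le_rfl
    have hα' := hα.mono (R.past_le_past_succ k) le_rfl
    have hd := (hR.d_meas k).mono hle le_rfl
    have hsuccess : MeasurableSet[R.past (k + 1)] {ω | R.Success P A k ω} :=
      measurableSet_setOf_success hh hc hx' ((R.measurable_g k).mono hle le_rfl) hd hα' hρ'
        (R.measurable_f0 k) (R.measurable_fs k)
    rw [show R.x (k + 1) = _ from funext fun ω => hR.x_succ ω,
      show R.α (k + 1) = _ from funext fun ω => hR.alpha_succ ω]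
    exact ⟨Measurable.ite hsuccess (hx'.add (hα'.smul hd)) hx', Measurable.ite hsuccess
      ((hα'.const_mul _).min measurable_const) (hα'.const_mul _), hρ'⟩

lemma past_le (hR : R.IsGenerated P A x₀) (k : ℕ) :
    R.past k ≤ (inferInstance : MeasurableSpace S) :=
  iSup_le fun i => sup_le (sup_le (hR.g_meas i).comap_le (hR.f0_meas i).comap_le)
    (hR.fs_meas i).comap_le

/-- The σ-algebras `𝓕_{k-1}`, indexed by `k`. -/
def filtration (hR : R.IsGenerated P A x₀) :
    Filtration ℕ (inferInstance : MeasurableSpace S) where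
  seq := R.past
  mono' := monotone_nat_of_le_succ R.past_le_past_succ
  le' := hR.past_le

lemma pg0_le (hR : R.IsGenerated P A x₀) (k : ℕ) (ω : S) : A.pg0 ≤ R.pg k ω := by
  induction k with
  | zero => exact (hR.pg_init ω).ge
  | succ k ih =>
    rcases lt_or_ge (R.ζ k ω) ‖R.g k ω‖ with h | h
    · rw [(hR.large k ω h).2.1]
      exact A.a_zero.trans (A.a_mono (Nat.zero_le _))
    · rwa [(hR.small k ω h).2.1]

end IsGenerated

/-- The event `I_k ∩ J_k` that all estimates of iteration `k` are accurate. -/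
def accurate (R : Run n S) (P : Problem n m₁ m₂) (κg εf : ℝ) (k : ℕ) : Set S :=
  R.gradAcc P κg k ∩ R.funAcc P εf k

namespace IsGenerated

variable [MeasurableSpace S]

lemma measurableSet_gradAcc (hR : R.IsGenerated P A x₀) (hf : ContDiff ℝ 1 P.f)
    (hh : ∀ i, ContDiff ℝ 1 (P.h i)) (hc : ∀ j, ContDiff ℝ 1 (P.c j)) (k : ℕ) :
    MeasurableSet[R.halfPast k] (R.gradAcc P κg k) := by
  obtain ⟨hx, hα, -⟩ := hR.measurable_past hh hc k
  exact Run.measurableSet_gradAcc hf (hx.mono (R.past_le_halfPast k) le_rfl) (R.measurable_g k)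
    (hR.d_meas k) (hα.mono (R.past_le_halfPast k) le_rfl)

lemma measurableSet_funAcc (hR : R.IsGenerated P A x₀) (hf : Measurable P.f)
    (hh : ∀ i, ContDiff ℝ 1 (P.h i)) (hc : ∀ j, ContDiff ℝ 1 (P.c j)) (k : ℕ) :
    MeasurableSet[R.past (k + 1)] (R.funAcc P εf k) := by
  obtain ⟨hx, hα, -⟩ := hR.measurable_past hh hc k
  exact Run.measurableSet_funAcc hf (hx.mono (R.past_le_past_succ k) le_rfl)
    ((hR.d_meas k).mono (R.halfPast_le_past_succ k) le_rfl)
    (hα.mono (R.past_le_past_succ k) le_rfl) (R.measurable_f0 k) (R.measurable_fs k)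

lemma measurableSet_accurate (hR : R.IsGenerated P A x₀) (hf : ContDiff ℝ 1 P.f)
    (hh : ∀ i, ContDiff ℝ 1 (P.h i)) (hc : ∀ j, ContDiff ℝ 1 (P.c j)) (k : ℕ) :
    MeasurableSet[R.past (k + 1)] (R.accurate P κg εf k) :=
  (R.halfPast_le_past_succ k _ (hR.measurableSet_gradAcc hf hh hc k)).inter
    (hR.measurableSet_funAcc hf.continuous.measurable hh hc k)

lemma ae_le_condExp_accurate {μ : Measure S} [IsFiniteMeasure μ] (hR : R.IsGenerated P A x₀)
    (hf : ContDiff ℝ 1 P.f) (hh : ∀ i, ContDiff ℝ 1 (P.h i)) (hc : ∀ j, ContDiff ℝ 1 (P.c j))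
    (hacc : R.ProbAccurate P A μ κg εf) (k : ℕ) :
    ∀ᵐ ω ∂μ, A.pf * A.pg0 ≤ (μ⟦R.accurate P κg εf k | R.past k⟧) ω :=
  ae_le_condExp_inter (R.past_le_halfPast k) ((R.halfPast_le_past_succ k).trans (hR.past_le _))
    (hR.measurableSet_gradAcc hf hh hc k)
    (hR.past_le _ _ (hR.measurableSet_funAcc hf.continuous.measurable hh hc k)) A.pf_pos.le
    ((hacc.grad k).mono fun ω hω => (hR.pg0_le k ω).trans hω) (hacc.func k)

end IsGenerated

end Run

end Measurability

section SamplePath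

variable {n m₁ m₂ : ℕ} {S : Type*}

namespace Problem

variable (P : Problem n m₁ m₂) {x d : Vec n} {ρ α : ℝ} {L : ℝ≥0}

/-- The exact penalty function `f + ρ φ`. -/
noncomputable def merit (ρ : ℝ) (x : Vec n) : ℝ := P.f x + ρ * P.phi x

lemma continuous_merit (hf : Continuous P.f) (hh : ∀ i, Continuous (P.h i))
    (hc : ∀ j, Continuous (P.c j)) : Continuous (P.merit ρ) :=
  hf.add ((P.continuous_phi hh hc).const_mul ρ)

lemma merit_add_smul_le (hf : Differentiable ℝ P.f) (hh : ∀ i, Differentiable ℝ (P.h i))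
    (hc : ∀ j, Differentiable ℝ (P.c j))
    (hfL : LipschitzOnWith L (∇ P.f) (segment ℝ x (x + α • d)))
    (hhL : ∀ i, LipschitzOnWith L (∇ (P.h i)) (segment ℝ x (x + α • d)))
    (hcL : ∀ j, LipschitzOnWith L (∇ (P.c j)) (segment ℝ x (x + α • d)))
    (hρ : 0 ≤ ρ) (hα₀ : 0 ≤ α) (hα₁ : α ≤ 1) :
    P.merit ρ (x + α • d) ≤ P.merit ρ x + α * (⟪∇ P.f x, d⟫ - ρ * (P.phi x - P.linPhi x d)) +
      (1 + ρ) * L * (α ^ 2 * ‖d‖ ^ 2) := by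
  have hnorm : ‖α • d‖ ^ 2 = α ^ 2 * ‖d‖ ^ 2 := by
    rw [norm_smul, mul_pow, Real.norm_eq_abs, sq_abs]
  have hf_le : P.f (x + α • d) ≤ P.f x + α * ⟪∇ P.f x, d⟫ + L * (α ^ 2 * ‖d‖ ^ 2) := by
    have h := (abs_le.1 (abs_sub_sub_inner_gradient_le (fun z _ => hf z) hfL)).2
    rw [add_sub_cancel_left, inner_smul_right, hnorm] at h
    linarith
  have hphi_le : P.phi (x + α • d) ≤
      (1 - α) * P.phi x + α * P.linPhi x d + L * (α ^ 2 * ‖d‖ ^ 2) := by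
    rw [← hnorm]
    exact (P.phi_add_le hh hc hhL hcL).trans (add_le_add_left (P.linPhi_smul_le hα₀ hα₁) _)
  rw [merit, merit]
  linarith [mul_le_mul_of_nonneg_left hphi_le hρ]

end Problem

namespace Run

variable {R : Run n S} {P : Problem n m₁ m₂} {A : Params} {x₀ : Vec n} {k : ℕ} {ω : S}
  {κg εf ξ MH ρ : ℝ} {L G : ℝ≥0} {Om : Set (Vec n)}

/-- The part of `Regular` that depends on the sample point: at `ω`, the steps stay in `Om` and the
matrices `H_k` are uniformly bounded and uniformly positive definite. -/
structure RegularAt (R : Run n S) (Om : Set (Vec n)) (ξ MH : ℝ) (ω : S) : Prop where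
  segment_subset : ∀ k, segment ℝ (R.x k ω) (R.trial k ω) ⊆ Om
  le_quadForm : ∀ k d, 2 * ξ * ‖d‖ ^ 2 ≤ quadForm (R.H k ω) d
  quadForm_le : ∀ k d, quadForm (R.H k ω) d ≤ MH * ‖d‖ ^ 2

lemma RegularAt.x_mem (h : R.RegularAt Om ξ MH ω) (k : ℕ) : R.x k ω ∈ Om :=
  h.segment_subset k (left_mem_segment ℝ _ _)

section Regular

variable [MeasurableSpace S] {μ : Measure S} {Lf : ℝ} {Lh : Fin m₁ → ℝ} {Lc : Fin m₂ → ℝ}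

lemma Regular.exists_lipschitzOnWith (h : R.Regular P μ Om Lf Lh Lc ξ MH) :
    ∃ L : ℝ≥0, LipschitzOnWith L (∇ P.f) Om ∧ (∀ i, LipschitzOnWith L (∇ (P.h i)) Om) ∧
      ∀ j, LipschitzOnWith L (∇ (P.c j)) Om := by
  have large {F : Vec n → ℝ} {l : ℝ}
      (hF : ∀ x ∈ Om, ∀ y ∈ Om, ‖∇ F x - ∇ F y‖ ≤ l * ‖x - y‖) :
      ∀ᶠ L : ℝ≥0 in atTop, LipschitzOnWith L (∇ F) Om := by
    filter_upwards [eventually_ge_atTop l.toNNReal] with L hL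
    refine (lipschitzOnWith_iff_norm_sub_le.2 fun x hx y hy => (hF x hx y hy).trans ?_).weaken hL
    gcongr
    exact Real.le_coe_toNNReal l
  exact ((large h.f_lip).and ((eventually_all.2 fun i => large (h.h_lip i)).and
    (eventually_all.2 fun j => large (h.c_lip j)))).exists

lemma Regular.exists_norm_gradient_le (h : R.Regular P μ Om Lf Lh Lc ξ MH) :
    ∃ G : ℝ≥0, ∀ x ∈ Om, (∀ i, ‖∇ (P.h i) x‖ ≤ G) ∧ ∀ j, ‖∇ (P.c j) x‖ ≤ G := by
  have large {F : Vec n → ℝ} (hF : Bornology.IsBounded (∇ F '' Om)) :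
      ∀ᶠ G : ℝ≥0 in atTop, ∀ x ∈ Om, ‖∇ F x‖ ≤ G := by
    obtain ⟨C, hC⟩ := hF.exists_norm_le
    filter_upwards [eventually_ge_atTop C.toNNReal] with G hG x hx
    exact (hC _ ⟨x, hx, rfl⟩).trans (Real.toNNReal_le_iff_le_coe.1 hG)
  obtain ⟨G, hh, hc⟩ := ((eventually_all.2 fun i => large (h.h_bdd i).2).and
    (eventually_all.2 fun j => large (h.c_bdd j).2)).exists
  exact ⟨G, fun x hx => ⟨fun i => hh i x hx, fun j => hc j x hx⟩⟩

lemma Regular.isCompact (h : R.Regular P μ Om Lf Lh Lc ξ MH) : IsCompact Om :=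
  Metric.isCompact_of_isClosed_isBounded h.closed h.bounded

lemma Regular.differentiable (h : R.Regular P μ Om Lf Lh Lc ξ MH) :
    Differentiable ℝ P.f ∧ (∀ i, Differentiable ℝ (P.h i)) ∧ ∀ j, Differentiable ℝ (P.c j) :=
  ⟨h.f_smooth.differentiable one_ne_zero, fun i => (h.h_smooth i).differentiable one_ne_zero,
    fun j => (h.c_smooth j).differentiable one_ne_zero⟩

end Regular

lemma mul_norm_sq_le_predRed (hω : R.RegularAt Om ξ MH ω) (hok : R.PenaltyOk P A k ω) :
    ξ * ‖R.d k ω‖ ^ 2 ≤ R.predRed P A k ω (R.ρ k ω) :=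
  le_trans (by linarith [hω.le_quadForm k (R.d k ω)]) hok

namespace IsGenerated

variable [MeasurableSpace S]

lemma alpha_pos (hR : R.IsGenerated P A x₀) (k : ℕ) (ω : S) : 0 < R.α k ω := by
  have hγ := one_pos.trans A.γ_gt
  induction k with
  | zero =>
    rw [hR.α_init]
    exact mul_pos (zpow_pos hγ _) A.αmax_pos
  | succ k ih =>
    rw [hR.alpha_succ]
    split_ifs
    exacts [lt_min (mul_pos hγ ih) A.αmax_pos, mul_pos (inv_pos.2 hγ) ih]

lemma inv_mul_alpha_le_self (hR : R.IsGenerated P A x₀) : A.γ⁻¹ * R.α k ω ≤ R.α k ω :=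
  mul_le_of_le_one_left (hR.alpha_pos k ω).le (inv_le_one_of_one_le₀ A.γ_gt.le)

lemma alpha_le (hR : R.IsGenerated P A x₀) (k : ℕ) (ω : S) : R.α k ω ≤ A.αmax := by
  induction k with
  | zero =>
    rw [hR.α_init]
    exact mul_le_of_le_one_left A.αmax_pos.le
      (zpow_le_one_of_nonpos₀ A.γ_gt.le A.j0_neg.le)
  | succ k ih =>
    rw [hR.alpha_succ]
    split_ifs
    exacts [min_le_right _ _, hR.inv_mul_alpha_le_self.trans ih]

lemma alpha_le_min (hR : R.IsGenerated P A x₀) : R.α k ω ≤ min (A.γ * R.α k ω) A.αmax :=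
  le_min (le_mul_of_one_le_left (hR.alpha_pos k ω).le A.γ_gt.le) (hR.alpha_le k ω)

lemma inv_mul_alpha_le (hR : R.IsGenerated P A x₀) (k : ℕ) (ω : S) :
    A.γ⁻¹ * R.α k ω ≤ R.α (k + 1) ω := by
  rw [hR.alpha_succ]
  split_ifs
  exacts [hR.inv_mul_alpha_le_self.trans hR.alpha_le_min, le_rfl]

lemma rho0_le (hR : R.IsGenerated P A x₀) (k : ℕ) (ω : S) : A.ρ0 ≤ R.ρ k ω := by
  induction k with
  | zero => exact (hR.ρ_init ω).ge
  | succ k ih =>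
    rw [hR.rho_succ]
    split_ifs
    exacts [ih, le_max_of_le_right (by linarith [A.ρ0_pos])]

lemma rho_pos (hR : R.IsGenerated P A x₀) (k : ℕ) (ω : S) : 0 < R.ρ k ω :=
  A.ρ0_pos.trans_le (hR.rho0_le k ω)

lemma rho_mono (hR : R.IsGenerated P A x₀) (ω : S) : Monotone fun k => R.ρ k ω := by
  refine monotone_nat_of_le_succ fun k => ?_
  rw [hR.rho_succ]
  split_ifs
  exacts [le_rfl, le_max_of_le_right (by linarith [hR.rho_pos k ω])]

lemma linPhi_d_le (hR : R.IsGenerated P A x₀) (k : ℕ) (ω : S) :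
    P.linPhi (R.x k ω) (R.d k ω) ≤ P.kappa (R.x k ω) (R.sigma P A k ω) :=
  ((P.mem_qpFeasible_iff (P.kappa_nonneg _ _)).1 (hR.d_mem k ω)).1

lemma ae_regularAt {μ : Measure S} {Lf : ℝ} {Lh : Fin m₁ → ℝ} {Lc : Fin m₂ → ℝ}
    (hR : R.IsGenerated P A x₀) (h : R.Regular P μ Om Lf Lh Lc ξ MH) :
    ∀ᵐ ω ∂μ, R.RegularAt Om ξ MH ω := by
  filter_upwards [h.mem, h.H_bdd] with ω hmem hH
  refine ⟨fun k => ?_, fun k d => (hH k d).1, fun k d => (hH k d).2⟩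
  rw [segment_eq_image', Set.image_subset_iff]
  intro t ht
  rw [Set.mem_preimage, trial, add_sub_cancel_left, smul_smul]
  have hα := (hR.alpha_pos k ω).le
  exact hmem k _ ⟨mul_nonneg ht.1 hα, mul_le_of_le_one_left hα ht.2⟩

/-! ### The penalty parameter -/

lemma exists_mem_qpSet_norm_le (hR : R.IsGenerated P A x₀) (k : ℕ) (ω : S) :
    ∃ p ∈ R.qpSet P A k ω, ‖p‖ ≤ √n * A.κu * P.phi (R.x k ω) := by
  obtain ⟨p, hp, hpκ⟩ := P.exists_linPhi_eq_kappa (R.x k ω) (R.sigma_nonneg (P := P) (A := A) ω)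
  have hσ : R.sigma P A k ω ≤ A.σu := min_le_left _ _
  refine ⟨p, (P.mem_qpFeasible_iff (P.kappa_nonneg _ _)).2 ⟨hpκ.le, ?_⟩, ?_⟩
  · linarith [A.σu_βl, A.σu_pos, (hR.β_mem k ω).1]
  · rw [mul_assoc]
    exact norm_le_of_supNorm_le (hp.trans (min_le_right _ _))

lemma qpObj_d_le (hR : R.IsGenerated P A x₀) (hω : R.RegularAt Om ξ MH ω) (hMH : 0 ≤ MH)
    {Γ Φ : ℝ} (hg : ‖R.g k ω‖ ≤ Γ) (hΦ : P.phi (R.x k ω) ≤ Φ) :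
    R.qpObj k ω (R.d k ω) ≤
      (Γ * (√n * A.κu) + MH * (√n * A.κu) ^ 2 * Φ / 2) * P.phi (R.x k ω) := by
  obtain ⟨p, hp, hpφ⟩ := hR.exists_mem_qpSet_norm_le k ω
  have hφ := P.phi_nonneg (R.x k ω)
  have hΓ : 0 ≤ Γ := (norm_nonneg _).trans hg
  calc R.qpObj k ω (R.d k ω) ≤ R.qpObj k ω p := hR.d_min k ω hp
    _ ≤ Γ * ‖p‖ + MH * ‖p‖ ^ 2 / 2 := by
        rw [qpObj]
        gcongr
        exacts [(real_inner_le_norm _ _).trans (by gcongr), hω.quadForm_le k p]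
    _ ≤ Γ * (√n * A.κu * P.phi (R.x k ω)) + MH * (√n * A.κu * P.phi (R.x k ω)) ^ 2 / 2 := by
        gcongr
    _ = (Γ * (√n * A.κu) + MH * (√n * A.κu) ^ 2 * P.phi (R.x k ω) / 2) * P.phi (R.x k ω) := by
        ring
    _ ≤ _ := by gcongr

lemma rho_le_of_not_penaltyOk (hR : R.IsGenerated P A x₀) {b B : ℝ} (hb : 0 < b)
    (hbφ : b * P.phi (R.x k ω) ≤ R.dPhi P A k ω)
    (hB : R.qpObj k ω (R.d k ω) ≤ B * P.phi (R.x k ω)) (hfail : ¬ R.PenaltyOk P A k ω) :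
    R.ρ k ω ≤ B / b := by
  have hlt : R.ρ k ω * R.dPhi P A k ω < R.qpObj k ω (R.d k ω) := by
    rw [PenaltyOk, predRed, not_le] at hfail
    rw [qpObj]
    linarith
  rw [le_div_iff₀ hb]
  refine (lt_of_mul_lt_mul_right ?_ (P.phi_nonneg (R.x k ω))).le
  calc R.ρ k ω * b * P.phi (R.x k ω) = R.ρ k ω * (b * P.phi (R.x k ω)) := mul_assoc _ _ _
    _ ≤ R.ρ k ω * R.dPhi P A k ω := mul_le_mul_of_nonneg_left hbφ (hR.rho_pos k ω).le
    _ < R.qpObj k ω (R.d k ω) := hlt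
    _ ≤ B * P.phi (R.x k ω) := hB

lemma eventually_penaltyOk (hR : R.IsGenerated P A x₀) {C : ℝ}
    (hC : ∀ᶠ k in atTop, ¬ R.PenaltyOk P A k ω → R.ρ k ω ≤ C) :
    ∀ᶠ k in atTop, R.PenaltyOk P A k ω := by
  by_contra hfail
  rw [not_eventually] at hfail
  have hbdd : BddAbove (Set.range fun k => R.ρ k ω) := by
    refine ⟨C, Set.forall_mem_range.2 fun k => ?_⟩
    obtain ⟨l, ⟨hl, hlC⟩, hkl⟩ :=
      ((hfail.and_eventually hC).and_eventually (eventually_ge_atTop k)).exists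
    exact (hR.rho_mono ω hkl).trans (hlC hl)
  have hlim := tendsto_atTop_ciSup (hR.rho_mono ω) hbdd
  have hdiff : Tendsto (fun k => R.ρ (k + 1) ω - R.ρ k ω) atTop (𝓝 0) := by
    simpa using ((tendsto_add_atTop_iff_nat 1).2 hlim).sub hlim
  obtain ⟨k, hk, hlt⟩ := (hfail.and_eventually (hdiff.eventually_lt_const A.ρ0_pos)).exists
  rw [hR.penalty_raise k ω hk] at hlt
  linarith [le_max_right (R.qpObj k ω (R.d k ω) / R.dPhi P A k ω) (2 * R.ρ k ω), hR.rho0_le k ω]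

lemma exists_eventually_rho_eq (hR : R.IsGenerated P A x₀)
    (hok : ∀ᶠ k in atTop, R.PenaltyOk P A k ω) : ∃ r > 0, ∀ᶠ k in atTop, R.ρ k ω = r := by
  obtain ⟨K, hK⟩ := eventually_atTop.1 hok
  exact ⟨R.ρ K ω, hR.rho_pos K ω, eventually_atTop.2 ⟨K, fun k hk => Nat.le_induction rfl
    (fun l hl ih => (hR.penalty_keep l ω (hK l hl)).trans ih) k hk⟩⟩

/-! ### The line search -/

lemma merit_trial_le (hR : R.IsGenerated P A x₀) (hf : Differentiable ℝ P.f)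
    (hh : ∀ i, Differentiable ℝ (P.h i)) (hc : ∀ j, Differentiable ℝ (P.c j))
    (hfL : LipschitzOnWith L (∇ P.f) (segment ℝ (R.x k ω) (R.trial k ω)))
    (hhL : ∀ i, LipschitzOnWith L (∇ (P.h i)) (segment ℝ (R.x k ω) (R.trial k ω)))
    (hcL : ∀ j, LipschitzOnWith L (∇ (P.c j)) (segment ℝ (R.x k ω) (R.trial k ω)))
    (hacc : ω ∈ R.gradAcc P κg k) (hρ : 0 ≤ ρ) (hα : R.α k ω ≤ 1) :
    P.merit ρ (R.trial k ω) ≤ P.merit ρ (R.x k ω) - R.α k ω * R.predRed P A k ω ρ +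
      (κg + (1 + ρ) * L) * (R.α k ω ^ 2 * ‖R.d k ω‖ ^ 2) := by
  have hα₀ := (hR.alpha_pos k ω).le
  have hgrad : ⟪∇ P.f (R.x k ω), R.d k ω⟫ - ⟪R.g k ω, R.d k ω⟫ ≤
      κg * R.α k ω * ‖R.d k ω‖ * ‖R.d k ω‖ := by
    rw [← inner_sub_left]
    refine (real_inner_le_norm _ _).trans (mul_le_mul_of_nonneg_right ?_ (norm_nonneg _))
    rw [norm_sub_rev]
    exact hacc
  have hlin : ρ * R.dPhi P A k ω ≤
      ρ * (P.phi (R.x k ω) - P.linPhi (R.x k ω) (R.d k ω)) :=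
    mul_le_mul_of_nonneg_left (sub_le_sub_left (hR.linPhi_d_le k ω) _) hρ
  have hmodel : ⟪∇ P.f (R.x k ω), R.d k ω⟫ -
        ρ * (P.phi (R.x k ω) - P.linPhi (R.x k ω) (R.d k ω)) ≤
      -R.predRed P A k ω ρ + κg * R.α k ω * ‖R.d k ω‖ * ‖R.d k ω‖ := by
    rw [predRed]
    linarith
  have hmerit := P.merit_add_smul_le hf hh hc hfL hhL hcL hρ hα₀ hα
  rw [← trial] at hmerit
  linarith [mul_le_mul_of_nonneg_left hmodel hα₀]

lemma success_of_accurate (hR : R.IsGenerated P A x₀) (hω : R.RegularAt Om ξ MH ω)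
    (hok : R.PenaltyOk P A k ω) (hacc : ω ∈ R.funAcc P εf k) {C : ℝ}
    (hmerit : P.merit (R.ρ k ω) (R.trial k ω) ≤ P.merit (R.ρ k ω) (R.x k ω) -
      R.α k ω * R.predRed P A k ω (R.ρ k ω) + C * (R.α k ω ^ 2 * ‖R.d k ω‖ ^ 2))
    (hα : R.α k ω * (C + 2 * εf) ≤ (1 - A.θ) * ξ) : R.Success P A k ω := by
  have hα₀ := (hR.alpha_pos k ω).le
  have herr : (C + 2 * εf) * (R.α k ω ^ 2 * ‖R.d k ω‖ ^ 2) ≤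
      (1 - A.θ) * R.α k ω * R.predRed P A k ω (R.ρ k ω) := calc
    _ = R.α k ω * (C + 2 * εf) * (R.α k ω * ‖R.d k ω‖ ^ 2) := by ring
    _ ≤ (1 - A.θ) * ξ * (R.α k ω * ‖R.d k ω‖ ^ 2) := by gcongr
    _ = (1 - A.θ) * R.α k ω * (ξ * ‖R.d k ω‖ ^ 2) := by ring
    _ ≤ _ := mul_le_mul_of_nonneg_left (mul_norm_sq_le_predRed hω hok)
        (mul_nonneg (sub_nonneg.2 A.θ_lt.le) hα₀)
  rw [Success, hR.penalty_keep k ω hok]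
  rw [Problem.merit, Problem.merit] at hmerit
  linarith [(abs_le.1 hacc.1).1, (abs_le.1 hacc.2).2]

lemma merit_succ_le_of_success (hR : R.IsGenerated P A x₀) (hω : R.RegularAt Om ξ MH ω)
    (hok : R.PenaltyOk P A k ω) (hξ : 0 ≤ ξ) (hε : εf ≤ ξ * A.θ / (4 * A.αmax))
    (hacc : ω ∈ R.funAcc P εf k) (hs : R.Success P A k ω) :
    P.merit (R.ρ k ω) (R.x (k + 1) ω) ≤ P.merit (R.ρ k ω) (R.x k ω) -
      ξ * A.θ / 2 * R.α k ω * ‖R.d k ω‖ ^ 2 := by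
  have hα₀ := (hR.alpha_pos k ω).le
  have hαm := A.αmax_pos
  have hθ := A.θ_pos
  have herr : εf * R.α k ω ^ 2 * ‖R.d k ω‖ ^ 2 ≤
      ξ * A.θ / 4 * R.α k ω * ‖R.d k ω‖ ^ 2 := by
    have hεα : εf * R.α k ω ≤ ξ * A.θ / 4 := calc
      εf * R.α k ω ≤ ξ * A.θ / (4 * A.αmax) * A.αmax := by
        gcongr
        exact hR.alpha_le k ω
      _ = ξ * A.θ / 4 := by field_simp
    calc εf * R.α k ω ^ 2 * ‖R.d k ω‖ ^ 2
        = εf * R.α k ω * (R.α k ω * ‖R.d k ω‖ ^ 2) := by ring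
      _ ≤ ξ * A.θ / 4 * (R.α k ω * ‖R.d k ω‖ ^ 2) := by gcongr
      _ = _ := by ring
  have hred := mul_le_mul_of_nonneg_left (mul_norm_sq_le_predRed hω hok) (mul_nonneg hθ.le hα₀)
  rw [(hR.success k ω hs).1, Problem.merit, Problem.merit]
  rw [Success, hR.penalty_keep k ω hok] at hs
  linarith [(abs_le.1 hacc.1).2, (abs_le.1 hacc.2).1]

/-! ### The search direction -/

lemma dPhi_le_mul_norm_d (hR : R.IsGenerated P A x₀) (hh : ∀ i, ‖∇ (P.h i) (R.x k ω)‖ ≤ G)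
    (hc : ∀ j, ‖∇ (P.c j) (R.x k ω)‖ ≤ G) : R.dPhi P A k ω ≤ G * ‖R.d k ω‖ := by
  rw [dPhi, Problem.deltaPhi]
  linarith [P.phi_le_linPhi_add (p := R.d k ω) hh hc, hR.linPhi_d_le k ω]

lemma add_smul_mem_qpSet (hR : R.IsGenerated P A x₀) {t : Vec n} {s : ℝ} (hs₀ : 0 ≤ s)
    (hs₁ : s ≤ 1) (hd : ‖R.d k ω‖ ≤ A.βl / 2) (hth : ∀ i, ⟪∇ (P.h i) (R.x k ω), t⟫ = 0)
    (htc : ∀ j, ⟪∇ (P.c j) (R.x k ω), t⟫ ≤ 0) (ht : supNorm t ≤ A.βl / 2) :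
    R.d k ω + s • t ∈ R.qpSet P A k ω := by
  obtain ⟨hdh, hdc, -⟩ := hR.d_mem k ω
  refine ⟨fun i => ?_, fun j => ?_, ?_⟩
  · simpa only [inner_add_right, inner_smul_right, hth i, mul_zero, add_zero] using hdh i
  · rw [inner_add_right, inner_smul_right]
    linarith [hdc j, mul_nonpos_of_nonneg_of_nonpos hs₀ (htc j)]
  · calc supNorm (R.d k ω + s • t) ≤ supNorm (R.d k ω) + supNorm (s • t) := supNorm_add_le _ _
      _ ≤ ‖R.d k ω‖ + 1 * supNorm t := by
          rw [supNorm_smul, abs_of_nonneg hs₀]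
          gcongr
          exacts [supNorm_le_norm _, supNorm_nonneg t]
      _ ≤ R.β k ω := by linarith [(hR.β_mem k ω).1]

lemma neg_le_inner_g (hR : R.IsGenerated P A x₀) (hω : R.RegularAt Om ξ MH ω) (hξ : 0 ≤ ξ)
    (hMH : 0 ≤ MH) {t : Vec n} {s T : ℝ} (hs : 0 < s) (hd : ‖R.d k ω‖ ≤ s) (ht : ‖t‖ ≤ T)
    (hmem : R.d k ω + s • t ∈ R.qpSet P A k ω) :
    -(MH * (1 + T) ^ 2 / 2 * s) ≤ ⟪R.g k ω, t⟫ := by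
  have hmin : R.qpObj k ω (R.d k ω) ≤ R.qpObj k ω (R.d k ω + s • t) := hR.d_min k ω hmem
  rw [qpObj, qpObj, inner_add_right, inner_smul_right] at hmin
  have hnorm : ‖R.d k ω + s • t‖ ≤ s * (1 + T) := calc
    _ ≤ ‖R.d k ω‖ + s * ‖t‖ := by
        simpa [norm_smul, abs_of_pos hs] using norm_add_le (R.d k ω) (s • t)
    _ ≤ s + s * T := by gcongr
    _ = s * (1 + T) := by ring
  have hupper : quadForm (R.H k ω) (R.d k ω + s • t) ≤ MH * (s * (1 + T)) ^ 2 :=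
    (hω.quadForm_le k _).trans (by gcongr)
  have hlower : 0 ≤ quadForm (R.H k ω) (R.d k ω) :=
    le_trans (by positivity) (hω.le_quadForm k _)
  refine le_of_mul_le_mul_left ?_ hs
  linarith

lemma chi_le (hR : R.IsGenerated P A x₀) (hω : R.RegularAt Om ξ MH ω) (hξ : 0 ≤ ξ)
    (hMH : 0 ≤ MH) {s η : ℝ} (hs₀ : 0 < s) (hs₁ : s ≤ 1) (hsβ : s ≤ A.βl / 2)
    (hd : ‖R.d k ω‖ ≤ s) (hg : ‖R.g k ω - ∇ P.f (R.x k ω)‖ ≤ η) :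
    P.chi A.βl (R.x k ω) ≤
      MH * (1 + √n * (A.βl / 2)) ^ 2 / 2 * s + η * (√n * (A.βl / 2)) := by
  refine P.chi_le_of_forall (by linarith) fun t hth htc ht => ?_
  have htnorm := norm_le_of_supNorm_le ht
  have hstep := hR.neg_le_inner_g hω hξ hMH hs₀ hd htnorm
    (hR.add_smul_mem_qpSet hs₀.le hs₁ (hd.trans hsβ) hth htc ht)
  have herr : ⟪R.g k ω, t⟫ - ⟪∇ P.f (R.x k ω), t⟫ ≤ η * (√n * (A.βl / 2)) := by
    rw [← inner_sub_left]
    exact (real_inner_le_norm _ _).trans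
      (mul_le_mul hg htnorm (norm_nonneg _) ((norm_nonneg _).trans hg))
  linarith

lemma exists_pos_le_norm_d (hR : R.IsGenerated P A x₀) (hω : R.RegularAt Om ξ MH ω)
    (hξ : 0 ≤ ξ) (hMH : 0 ≤ MH)
    (hG : ∀ x ∈ Om, (∀ i, ‖∇ (P.h i) x‖ ≤ G) ∧ ∀ j, ‖∇ (P.c j) x‖ ≤ G) {b ε : ℝ} (hb : 0 < b)
    (hε : 0 < ε) :
    ∃ δ > 0, ∀ k, b * P.phi (R.x k ω) ≤ R.dPhi P A k ω → ω ∈ R.gradAcc P κg k →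
      ε ≤ R.optMeasure P A k ω → δ ≤ ‖R.d k ω‖ := by
  have hβ : 0 < A.βl := by linarith [A.σu_βl, A.σu_pos]
  set T := √n * (A.βl / 2)
  set C : ℝ → ℝ := fun δ => MH * (1 + T) ^ 2 / 2 * δ + |κg| * A.αmax * δ * T
  have hcont : Continuous fun δ => (G * δ / b) ^ 2 + C δ ^ 2 := by fun_prop
  have hsmall : ∀ᶠ δ in 𝓝 (0 : ℝ), (δ ≤ 1 ∧ δ ≤ A.βl / 2) ∧ (G * δ / b) ^ 2 + C δ ^ 2 < ε :=
    ((eventually_le_nhds one_pos).and (eventually_le_nhds (half_pos hβ))).and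
      ((hcont.tendsto 0).eventually_lt_const (by simpa [C] using hε))
  obtain ⟨δ, ⟨⟨hδ₁, hδβ⟩, hδε⟩, hδ : 0 < δ⟩ := ((hsmall.filter_mono nhdsWithin_le_nhds).and
    (self_mem_nhdsWithin (a := (0 : ℝ)) (s := Set.Ioi 0))).exists
  refine ⟨δ, hδ, fun k hbφ hacc hopt => ?_⟩
  by_contra! hd
  obtain ⟨hGh, hGc⟩ := hG _ (hω.x_mem k)
  have hphi : P.phi (R.x k ω) ≤ G * δ / b := by
    rw [le_div_iff₀' hb]
    exact (hbφ.trans (hR.dPhi_le_mul_norm_d hGh hGc)).trans (by gcongr)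
  have hgrad : ‖R.g k ω - ∇ P.f (R.x k ω)‖ ≤ |κg| * A.αmax * δ := by
    refine le_trans hacc ?_
    gcongr
    exacts [mul_nonneg (abs_nonneg κg) A.αmax_pos.le, (hR.alpha_pos k ω).le, le_abs_self κg,
      hR.alpha_le k ω]
  have hchi : P.chi A.βl (R.x k ω) ≤ C δ := hR.chi_le hω hξ hMH hδ hδ₁ hδβ hd.le hgrad
  have : R.optMeasure P A k ω ≤ (G * δ / b) ^ 2 + C δ ^ 2 :=
    add_le_add (pow_le_pow_left₀ (P.phi_nonneg _) hphi 2)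
      (pow_le_pow_left₀ (P.chi_nonneg hβ.le _) hchi 2)
  linarith

end IsGenerated

end Run

end SamplePath

namespace Run

variable {n m₁ m₂ : ℕ} {S : Type*} [MeasurableSpace S] {R : Run n S} {P : Problem n m₁ m₂}
  {A : Params} {x₀ : Vec n} {μ : Measure S} {Om : Set (Vec n)} {Lf : ℝ} {Lh : Fin m₁ → ℝ}
  {Lc : Fin m₂ → ℝ} {ξ MH κg εf : ℝ} {k : ℕ} {ω : S}

/-! ### Convergence along a sample path -/

lemma RegularAt.exists_eventually_mul_phi_le_dPhi (hω : R.RegularAt Om ξ MH ω)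
    (hreg : R.Regular P μ Om Lf Lh Lc ξ MH)
    (hcl : ∀ y, MapClusterPt y atTop (fun k => R.x k ω) → P.EMFCQ y) :
    ∃ b > 0, ∀ᶠ k in atTop, b * P.phi (R.x k ω) ≤ R.dPhi P A k ω :=
  exists_eventually_mul_le_of_mapClusterPt hreg.isCompact (.of_forall hω.x_mem) P.phi_nonneg
    fun y hy => (hcl y hy).exists_le_deltaPhi hreg.h_smooth hreg.c_smooth A.σu_pos A.κu_pos

namespace IsGenerated

lemma eventually_penaltyOk_of_bddAbove (hR : R.IsGenerated P A x₀)
    (hreg : R.Regular P μ Om Lf Lh Lc ξ MH) (hω : R.RegularAt Om ξ MH ω) {b : ℝ} (hb : 0 < b)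
    (hbφ : ∀ᶠ k in atTop, b * P.phi (R.x k ω) ≤ R.dPhi P A k ω)
    (hbdd : BddAbove (Set.range fun k => ‖R.g k ω‖) ∨ BddAbove (Set.range fun k => R.ρ k ω)) :
    ∀ᶠ k in atTop, R.PenaltyOk P A k ω := by
  rcases hbdd with ⟨Γ, hΓ⟩ | ⟨C, hC⟩
  · obtain ⟨Φ, hΦ⟩ := hreg.isCompact.bddAbove_image (P.continuous_phi
      (fun i => (hreg.h_smooth i).continuous) fun j => (hreg.c_smooth j).continuous).continuousOn
    exact hR.eventually_penaltyOk (hbφ.mono fun k hk => hR.rho_le_of_not_penaltyOk hb hk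
      (hR.qpObj_d_le hω hreg.MH_pos.le (hΓ ⟨k, rfl⟩) (hΦ ⟨_, hω.x_mem k, rfl⟩)))
  · exact hR.eventually_penaltyOk (.of_forall fun k _ => hC ⟨k, rfl⟩)

lemma exists_success_of_alpha_le (hR : R.IsGenerated P A x₀)
    (hreg : R.Regular P μ Om Lf Lh Lc ξ MH) (hω : R.RegularAt Om ξ MH ω) {r : ℝ} (hr : 0 ≤ r) :
    ∃ a > 0, A.γ * a ≤ A.αmax ∧ ∀ k, R.PenaltyOk P A k ω → R.ρ k ω = r →
      ω ∈ R.accurate P κg εf k → R.α k ω ≤ a → R.Success P A k ω := by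
  obtain ⟨L, hfL, hhL, hcL⟩ := hreg.exists_lipschitzOnWith
  obtain ⟨hf, hh, hc⟩ := hreg.differentiable
  have small {M B : ℝ} (hB : 0 < B) : ∀ᶠ s in 𝓝 (0 : ℝ), s * M ≤ B :=
    (continuous_mul_const M).continuousAt.eventually_le_const (by simpa using hB)
  obtain ⟨a, ha, hsmall⟩ := mem_nhdsGT_iff_exists_Ioc_subset.1 (mem_nhdsWithin_of_mem_nhds
    ((small (M := 1) one_pos).and ((small (M := A.γ) A.αmax_pos).and
      (small (M := κg + (1 + r) * L + 2 * εf)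
        (mul_pos (sub_pos.2 A.θ_lt) hreg.ξ_pos)))))
  refine ⟨a, ha, by simpa only [mul_comm] using (hsmall ⟨ha, le_rfl⟩).2.1,
    fun k hok hρ hacc hα => ?_⟩
  obtain ⟨hα₁, -, hαC⟩ := hsmall ⟨hR.alpha_pos k ω, hα⟩
  have hseg := hω.segment_subset k
  refine hR.success_of_accurate hω hok hacc.2 ?_ hαC
  rw [hρ]
  exact hR.merit_trial_le hf hh hc (hfL.mono hseg) (fun i => (hhL i).mono hseg)
    (fun j => (hcL j).mono hseg) hacc.1 hr (by simpa using hα₁)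

lemma descentStep_of_funAcc (hR : R.IsGenerated P A x₀) (hω : R.RegularAt Om ξ MH ω)
    (hξ : 0 ≤ ξ) (hε : εf ≤ ξ * A.θ / (4 * A.αmax)) {a δ : ℝ} (hδ : 0 ≤ δ)
    (hok : R.PenaltyOk P A k ω) (hacc : ω ∈ R.funAcc P εf k) (hd : δ ≤ ‖R.d k ω‖)
    (hsucc : R.α k ω ≤ a → R.Success P A k ω) :
    DescentStep A.γ (ξ * A.θ / 2 * δ ^ 2) a (fun l => P.merit (R.ρ k ω) (R.x l ω))
      (fun l => R.α l ω) k := by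
  by_cases hs : R.Success P A k ω
  · refine .inl ⟨?_, ?_, ?_⟩
    · have hα₀ := (hR.alpha_pos k ω).le
      have hθ := A.θ_pos
      have hdrop : ξ * A.θ / 2 * δ ^ 2 * R.α k ω ≤ ξ * A.θ / 2 * R.α k ω * ‖R.d k ω‖ ^ 2 := by
        rw [mul_right_comm]
        gcongr
      exact (hR.merit_succ_le_of_success hω hok hξ hε hacc hs).trans (sub_le_sub_left hdrop _)
    · exact hR.alpha_le_min.trans (hR.success k ω hs).2.ge
    · exact (hR.success k ω hs).2.trans_le (min_le_left _ _)
  · obtain ⟨hx, hα⟩ := hR.failure k ω hs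
    exact .inr ⟨congrArg _ hx, hα, not_le.1 fun h => hs (hsucc h)⟩

lemma mul_alpha_le_of_success (hR : R.IsGenerated P A x₀) {a : ℝ} (haγ : A.γ * a ≤ A.αmax)
    (hα : R.α k ω ≤ a) (hs : R.Success P A k ω) : A.γ * R.α k ω ≤ R.α (k + 1) ω := by
  rw [(hR.success k ω hs).2]
  exact le_min le_rfl
    ((mul_le_mul_of_nonneg_left hα (one_pos.trans A.γ_gt).le).trans haγ)

lemma exists_eventually_descentStep (hR : R.IsGenerated P A x₀)
    (hreg : R.Regular P μ Om Lf Lh Lc ξ MH) (hω : R.RegularAt Om ξ MH ω)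
    (hε : εf ≤ ξ * A.θ / (4 * A.αmax))
    (hcl : ∀ y, MapClusterPt y atTop (fun k => R.x k ω) → P.EMFCQ y)
    (hbdd : BddAbove (Set.range fun k => ‖R.g k ω‖) ∨ BddAbove (Set.range fun k => R.ρ k ω))
    {ε : ℝ} (hε₀ : 0 < ε) (hopt : ∀ᶠ k in atTop, ε ≤ R.optMeasure P A k ω) :
    ∃ r, ∃ D > 0, ∃ a > 0, ∀ᶠ k in atTop, ω ∈ R.accurate P κg εf k →
      DescentStep A.γ D a (fun l => P.merit r (R.x l ω)) (fun l => R.α l ω) k ∧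
        (R.α k ω < a → A.γ * R.α k ω ≤ R.α (k + 1) ω) := by
  obtain ⟨b, hb, hbφ⟩ := hω.exists_eventually_mul_phi_le_dPhi (A := A) hreg hcl
  have hok := hR.eventually_penaltyOk_of_bddAbove hreg hω hb hbφ hbdd
  obtain ⟨r, hr, hρ⟩ := hR.exists_eventually_rho_eq hok
  obtain ⟨G, hG⟩ := hreg.exists_norm_gradient_le
  obtain ⟨δ, hδ, hd⟩ :=
    hR.exists_pos_le_norm_d (κg := κg) hω hreg.ξ_pos.le hreg.MH_pos.le hG hb hε₀
  obtain ⟨a, ha, haγ, hsucc⟩ :=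
    hR.exists_success_of_alpha_le (κg := κg) (εf := εf) hreg hω hr.le
  refine ⟨r, ξ * A.θ / 2 * δ ^ 2, mul_pos (half_pos (mul_pos hreg.ξ_pos A.θ_pos)) (pow_pos hδ 2),
    a, ha, ?_⟩
  filter_upwards [hbφ, hok, hρ, hopt] with k hbφk hokk hρk hoptk hacc
  have hsucck := hsucc k hokk hρk hacc
  refine ⟨?_, fun hα => hR.mul_alpha_le_of_success haγ hα.le (hsucck hα.le)⟩
  rw [← hρk]
  exact hR.descentStep_of_funAcc hω hreg.ξ_pos.le hε hδ.le hokk hacc.2 (hd k hbφk hacc.1 hoptk)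
    hsucck

lemma frequently_optMeasure_lt (hR : R.IsGenerated P A x₀)
    (hreg : R.Regular P μ Om Lf Lh Lc ξ MH) (hω : R.RegularAt Om ξ MH ω)
    (hε : εf ≤ ξ * A.θ / (4 * A.αmax))
    (hcl : ∀ y, MapClusterPt y atTop (fun k => R.x k ω) → P.EMFCQ y)
    (hbdd : BddAbove (Set.range fun k => ‖R.g k ω‖) ∨ BddAbove (Set.range fun k => R.ρ k ω))
    (hwalk : ¬ BddAbove (Set.range fun N => walk (R.accurate P κg εf) (1 / 2) N ω))
    (hrun : ∀ (b : ℚ) (N : ℕ), (∃ᶠ k in atTop, (b : ℝ) ≤ R.α k ω) →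
      ∃ᶠ k in atTop, (b : ℝ) ≤ R.α k ω ∧ ∀ i < N, ω ∈ R.accurate P κg εf (k + i))
    {ε : ℝ} (hε₀ : 0 < ε) : ∃ᶠ k in atTop, R.optMeasure P A k ω < ε := by
  by_contra hopt
  simp only [not_frequently, not_lt] at hopt
  obtain ⟨r, D, hD, a, ha, hdesc⟩ :=
    hR.exists_eventually_descentStep (κg := κg) hreg hω hε hcl hbdd hε₀ hopt
  have hlarge : ∃ᶠ k in atTop, a ≤ R.α k ω :=
    frequently_le_of_not_bddAbove_walk A.γ_gt (hR.alpha_pos · ω) (hR.inv_mul_alpha_le · ω)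
      (hdesc.mono fun k hk hacc => (hk hacc).2) hwalk
  obtain ⟨b, hb, hba⟩ := exists_rat_btwn ha
  obtain ⟨M, hM⟩ := hreg.isCompact.exists_bound_of_continuousOn (P.continuous_merit (ρ := r)
    hreg.f_smooth.continuous (fun i => (hreg.h_smooth i).continuous)
    fun j => (hreg.c_smooth j).continuous).continuousOn
  obtain ⟨N, hN⟩ := exists_not_forall_descentStep A.γ_gt hD ha hb (hR.alpha_le · ω)
    fun k => hM _ (hω.x_mem k)
  obtain ⟨k, ⟨hbk, hacc⟩, hk⟩ := ((hrun b N (hlarge.mono fun k => hba.le.trans)).and_eventually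
    (eventually_forall_ge_atTop.2 hdesc)).exists
  exact hN k hbk fun i hi => (hk (k + i) (k.le_add_right i) (hacc i hi)).1

section Probability

variable [IsFiniteMeasure μ]

lemma ae_not_bddAbove_walk_accurate (hR : R.IsGenerated P A x₀) (hf : ContDiff ℝ 1 P.f)
    (hh : ∀ i, ContDiff ℝ 1 (P.h i)) (hc : ∀ j, ContDiff ℝ 1 (P.c j))
    (hacc : R.ProbAccurate P A μ κg εf) {q : ℝ} (hq : q < A.pf * A.pg0) :
    ∀ᵐ ω ∂μ, ¬ BddAbove (Set.range fun N => walk (R.accurate P κg εf) q N ω) :=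
  ae_not_bddAbove_walk (ℱ := hR.filtration) (hR.measurableSet_accurate hf hh hc) hq
    (hR.ae_le_condExp_accurate hf hh hc hacc)

lemma ae_frequently_run_accurate (hR : R.IsGenerated P A x₀) (hf : ContDiff ℝ 1 P.f)
    (hh : ∀ i, ContDiff ℝ 1 (P.h i)) (hc : ∀ j, ContDiff ℝ 1 (P.c j))
    (hacc : R.ProbAccurate P A μ κg εf) (b : ℝ) (N : ℕ) :
    ∀ᵐ ω ∂μ, (∃ᶠ k in atTop, b ≤ R.α k ω) →
      ∃ᶠ k in atTop, b ≤ R.α k ω ∧ ∀ i < N, ω ∈ R.accurate P κg εf (k + i) :=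
  ae_frequently_run (ℱ := hR.filtration) (B := fun k => {ω | b ≤ R.α k ω}) N
    (fun k => measurableSet_le measurable_const (hR.measurable_past hh hc k).2.1)
    (hR.measurableSet_accurate hf hh hc) (mul_pos A.pf_pos A.pg0_pos)
    (hR.ae_le_condExp_accurate hf hh hc hacc)

end Probability

end IsGenerated

end Run

end StochSQP

theorem mainTheorem1_general {n m₁ m₂ : ℕ} (P : StochSQP.Problem n m₁ m₂) (A : StochSQP.Params)
    (x₀ : StochSQP.Vec n)
    {S : Type*} [MeasurableSpace S] (μ : Measure S) [IsFiniteMeasure μ]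
    (R : StochSQP.Run n S) (hR : R.IsGenerated P A x₀)
    (Om : Set (StochSQP.Vec n)) (Lf : ℝ) (Lh : Fin m₁ → ℝ) (Lc : Fin m₂ → ℝ) (ξ MH : ℝ)
    (h1 : R.Regular P μ Om Lf Lh Lc ξ MH)
    (κg εf : ℝ)
    (h2 : R.ProbAccurate P A μ κg εf)
    (hp : 1 / 2 < A.pf * A.pg0)
    (hε : εf ≤ ξ * A.θ / (4 * A.αmax))
    (h3 : R.EMFCQAtAccPts P μ) :
    ∀ᵐ ω ∂μ,
      (BddAbove (Set.range fun k => ‖R.g k ω‖) ∨ BddAbove (Set.range fun k => R.ρ k ω)) →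
        liminf (fun k => ((R.optMeasure P A k ω : ℝ) : EReal)) atTop = 0 := by
  have hwalk := hR.ae_not_bddAbove_walk_accurate h1.f_smooth h1.h_smooth h1.c_smooth h2 hp
  have hrun : ∀ᵐ ω ∂μ, ∀ (b : ℚ) (N : ℕ), (∃ᶠ k in atTop, (b : ℝ) ≤ R.α k ω) →
      ∃ᶠ k in atTop, (b : ℝ) ≤ R.α k ω ∧ ∀ i < N, ω ∈ R.accurate P κg εf (k + i) :=
    ae_all_iff.2 fun b => ae_all_iff.2
      (hR.ae_frequently_run_accurate h1.f_smooth h1.h_smooth h1.c_smooth h2 b)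
  filter_upwards [hwalk, hrun, hR.ae_regularAt h1, h3] with ω hwalkω hrunω hω hcl hbdd
  exact StochSQP.liminf_coe_ereal_eq_zero (fun k => add_nonneg (sq_nonneg _) (sq_nonneg _))
    fun ε hε₀ => hR.frequently_optMeasure_lt h1 hω hε hcl hbdd hwalkω hrunω hε₀

theorem mainTheorem1 {n m₁ m₂ : ℕ} (P : StochSQP.Problem n m₁ m₂) (A : StochSQP.Params)
    (x₀ : StochSQP.Vec n)
    {S : Type*} [MeasurableSpace S] (μ : Measure S) [IsProbabilityMeasure μ]
    (R : StochSQP.Run n S) (hR : R.IsGenerated P A x₀)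
    (Om : Set (StochSQP.Vec n)) (Lf : ℝ) (Lh : Fin m₁ → ℝ) (Lc : Fin m₂ → ℝ) (ξ MH : ℝ)
    (h1 : R.Regular P μ Om Lf Lh Lc ξ MH)
    (κg εf : ℝ) (hκg : 0 < κg) (hεf : 0 < εf)
    (h2 : R.ProbAccurate P A μ κg εf)
    (hp : 1 / 2 < A.pf * A.pg0)
    (hε : εf < ξ * A.θ / (4 * A.αmax))
    (h3 : R.EMFCQAtAccPts P μ)
    (κf : ℝ) (hκf : 0 < κf)
    (h4 : R.VarianceCond P A μ κf) :
    ∀ᵐ ω ∂μ,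
      (BddAbove (Set.range fun k => ‖R.g k ω‖) ∨ BddAbove (Set.range fun k => R.ρ k ω)) →
        liminf (fun k => ((R.optMeasure P A k ω : ℝ) : EReal)) atTop = 0 :=
  mainTheorem1_general P A x₀ μ R hR Om Lf Lh Lc ξ MH h1 κg εf h2 hp hε.le h3
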